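/- Let $\mathcal{T}$ be a triangulated category with suspension $\Sigma$. Its graded center $Z^*(\mathcal{T})$ has as degree $n$ component the natural transformations $f\colon \mathrm{Id}\to\Sigma^n$ with $f_{\Sigma X}=(-1)^n\Sigma f_X$ for all $X$. Let $R=\bigoplus_{i\ge 0}R_i$ be a graded-commutative ring (that is, $rs=(-1)^{|r||s|}sr$ for homogeneous $r,s$) acting centrally on $\mathcal{T}$, i.e. equipped with a homomorphism of graded rings $R\to Z^*(\mathcal{T})$; write $\varphi_X(r)\colon X\to\Sigma^{|r|}X$ for the value at $X$ of the image of a homogeneous element $r$. For objects $X,Y$, the graded group $\mathrm{Hom}^*(X,Y)=\bigoplus_{i\in\mathbb{Z}}\mathrm{Hom}_{\mathcal{T}}(X,\Sigma^iY)$ is a graded $R$-module via $r\cdot g=\Sigma^{m}\varphi_Y(r)\circ g$ for $g\colon X\to\Sigma^mY$, and $\mathrm{Hom}^{\ge n}(X,Y)$ denotes its submodule of elements supported in degrees $\ge n$. The module $\mathrm{Hom}^*(X,Y)$ is called eventually Noetherian of finite length if $\mathrm{Hom}^{\ge n_0}(X,Y)$ is a Noetherian $R$-module for some $n_0\in\mathbb{Z}$,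 and there is $n_0\in\mathbb{Z}$ such that the $R_0$-module $\mathrm{Hom}_{\mathcal{T}}(X,\Sigma^nY)$ has finite length for all $n\ge n_0$. Let $R^{\mathrm{ev}}=\bigoplus_{i\ge0}R_{2i}$. The complexity $\mathrm{cx}\,X$ is the Krull dimension (the dimension of the support) of the $R^{\mathrm{ev}}$-module $\mathrm{Hom}^{\ge n}(X,X)$ for $n\gg0$, equivalently the infimum of these dimensions over all $n\in\mathbb{Z}$, where the zero module is given dimension $0$. Let $X$ be an object such that $\mathrm{Hom}^*(X,X)$ is eventually Noetherian of finite length. If $\mathrm{cx}\,X\neq0$, then $\mathrm{cx}\,X$ is finite, and there exists a homogeneous element $r\in R$ of positive degree such that every Koszul object $X/\!\!/r$, i.e. every object fitting into a distinguished triangle $$X\xrightarrow{\varphi_X(r)}\Sigma^{|r|}X\to X/\!\!/r\to\Sigma X$$ (such an object exists and is unique up to isomorphism), satisfies $\mathrm{cx}(X/\!\!/r)=\mathrm{cx}\,X-1$. -/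

import Mathlib

open CategoryTheory CategoryTheory.Limits CategoryTheory.Pretriangulated DirectSum

universe v u w

noncomputable section

/-! ### Graded-commutative rings -/

section Rings

variable {R : Type w} [Ring R] (𝒜 : ℕ → AddSubgroup R)

/-- Graded commutativity: `r s = (-1)^{|r||s|} s r` for homogeneous `r`, `s`. -/
class IsGradedCommutative : Prop where
  comm : ∀ (i j : ℕ) (r s : R), r ∈ 𝒜 i → s ∈ 𝒜 j → r * s = (-1) ^ (i * j) * (s * r)

variable [GradedRing 𝒜]

/-- The subring `R^ev = ⨁ R_{2i}`: all homogeneous components of odd degree vanish. -/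
def evenSubring : Subring R where
  carrier := {r | ∀ i : ℕ, Odd i → (DirectSum.decompose 𝒜 r i : R) = 0}
  zero_mem' := by intro i _; simp
  one_mem' := by
    intro i hi
    have h0 : i ≠ 0 := by rintro rfl; simp at hi
    exact DirectSum.decompose_of_mem_ne 𝒜 SetLike.GradedOne.one_mem h0.symm
  add_mem' := by
    intro a b ha hb i hi
    simp [DirectSum.decompose_add, ha i hi, hb i hi]
  neg_mem' := by
    intro a ha i hi
    have h : DirectSum.decompose 𝒜 a i = 0 := Subtype.ext (ha i hi)
    have h' : DirectSum.decompose 𝒜 (-a) i = -DirectSum.decompose 𝒜 a i := by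
      rw [DirectSum.decompose_neg]; rfl
    rw [h', h]; simp
  mul_mem' := by
    classical
    intro a b ha hb i hi
    rw [DirectSum.decompose_mul, DirectSum.coe_mul_apply]
    refine Finset.sum_eq_zero fun p hp => ?_
    have hp2 : p.1 + p.2 = i := (Finset.mem_filter.mp hp).2
    rcases Nat.even_or_odd p.1 with h1 | h1
    · have h2 : Odd p.2 := by
        rw [← hp2] at hi
        by_contra h
        exact (Nat.not_odd_iff_even.mpr (h1.add (Nat.not_odd_iff_even.mp h))) hi
      rw [hb _ h2, mul_zero]
    · rw [ha _ h1, zero_mul]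

instance evenSubring.instCommRing [IsGradedCommutative 𝒜] : CommRing (evenSubring 𝒜) :=
  { (inferInstance : Ring (evenSubring 𝒜)) with
    mul_comm := by
      classical
      rintro ⟨a, ha⟩ ⟨b, hb⟩
      apply Subtype.ext
      change a * b = b * a
      rw [← DirectSum.sum_support_decompose 𝒜 a, ← DirectSum.sum_support_decompose 𝒜 b,
        Finset.sum_mul_sum, Finset.sum_mul_sum, Finset.sum_comm]
      refine Finset.sum_congr rfl fun j _ => Finset.sum_congr rfl fun i _ => ?_
      rcases Nat.even_or_odd i with h1 | h1
      · rw [IsGradedCommutative.comm (𝒜 := 𝒜) i j _ _ (SetLike.coe_mem _) (SetLike.coe_mem _),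
          (h1.mul_right j).neg_one_pow, one_mul]
      · rw [ha i h1, zero_mul, mul_zero] }

end Rings

/-! ### The graded center and central actions -/

section Center

variable (C : Type u) [Category.{v} C] [Preadditive C] [HasShift C ℤ]
  [∀ n : ℤ, (shiftFunctor C n).Additive]

/-- The degree `n` component of the graded center: natural transformations
`f : Id ⟶ Σⁿ` with `f_{ΣX} = (-1)ⁿ Σ f_X`, where `ΣⁿΣX` and `ΣΣⁿX` are identified by the
canonical isomorphism. -/
def gradedCenter (n : ℤ) : AddSubgroup (𝟭 C ⟶ shiftFunctor C n) where
  carrier := {f | ∀ X : C, f.app (X⟦(1 : ℤ)⟧) =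
    n.negOnePow • ((f.app X)⟦(1 : ℤ)⟧' ≫ (shiftComm X n (1 : ℤ)).hom)}
  zero_mem' := by intro X; simp
  add_mem' := by
    intro f g hf hg X
    rw [NatTrans.app_add, hf X, hg X, NatTrans.app_add, Functor.map_add,
      Preadditive.add_comp, smul_add]
  neg_mem' := by
    intro f hf X
    rw [NatTrans.app_neg, hf X, NatTrans.app_neg, Functor.map_neg,
      Preadditive.neg_comp, smul_neg]

variable {C}

/-- The unit of the graded center, `Id ≅ Σ⁰`. -/
def gradedCenter.one (n : ℤ) (hn : n = 0) : gradedCenter C n :=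
  ⟨(shiftFunctorZero' C n hn).inv, by
    subst hn
    intro X
    have k : (shiftFunctorComm C (0 : ℤ) (1 : ℤ)).hom.app X =
        (shiftFunctorComm C (1 : ℤ) (0 : ℤ)).inv.app X := by
      rw [← shiftFunctorComm_symm C (0 : ℤ) (1 : ℤ)]; rfl
    simp only [shiftComm, Iso.app_hom, k, Int.negOnePow_zero, one_smul]
    rw [← cancel_mono ((shiftFunctorComm C (1 : ℤ) (0 : ℤ)).hom.app X), Category.assoc,
      Iso.inv_hom_id_app, shiftFunctorComm_zero_hom_app]
    simp [shiftFunctorZero']⟩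

/-- The product of the graded center: for `f` and `g` in degrees `m` and `n`, the product `fg` is
`X ⟶ ΣⁿX ⟶ Σᵐ⁺ⁿX`, first `g_X` and then `Σⁿ f_X`. -/
def gradedCenter.mul {m n k : ℤ} (f : gradedCenter C m) (g : gradedCenter C n) (h : m + n = k) :
    gradedCenter C k :=
  ⟨{ app := fun X =>
      ShiftedHom.comp (X := X) (Y := X) (Z := X) (g.1.app X) (f.1.app X) h
     naturality := by
      intro X Y p
      have hg := g.1.naturality p
      have hf := f.1.naturality p
      dsimp at hg hf
      dsimp [ShiftedHom.comp]
      rw [reassoc_of% hg, ← Functor.map_comp_assoc, hf, Functor.map_comp_assoc]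
      have hs := (shiftFunctorAdd' C m n k h).inv.naturality p
      dsimp at hs
      simp [hs] }, by
    subst h
    intro X
    have hf' := f.2 X
    have hg' := g.2 X
    dsimp [ShiftedHom.comp]
    rw [hf', hg', Int.negOnePow_add]
    have key := shiftFunctorComm_hom_app_comp_shift_shiftFunctorAdd_hom_app (C := C) (1 : ℤ) m n X
    rw [Functor.map_units_smul]
    simp only [Linear.units_smul_comp, Linear.comp_units_smul, smul_smul, Functor.map_comp,
      Category.assoc]
    congr 1
    have nat := (shiftFunctorComm C n (1 : ℤ)).hom.naturality (f.1.app X)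
    dsimp at nat
    simp only [shiftComm, Iso.app_hom]
    congr 1
    rw [shiftFunctorAdd'_eq_shiftFunctorAdd, ← reassoc_of% nat]
    congr 1
    have a (i : ℤ) (Y : C) : (shiftFunctorComm C i (1 : ℤ)).hom.app Y =
        (shiftFunctorComm C (1 : ℤ) i).inv.app Y := by
      rw [← shiftFunctorComm_symm C i (1 : ℤ)]; rfl
    rw [← cancel_mono ((shiftFunctorAdd C m n).hom.app (X⟦(1 : ℤ)⟧)),
      ← cancel_epi (((shiftFunctorAdd C m n).hom.app X)⟦(1 : ℤ)⟧'), a, a, a]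
    have key' : ((shiftFunctorAdd C m n).hom.app X)⟦(1 : ℤ)⟧' =
        (shiftFunctorComm C (1 : ℤ) (m + n)).inv.app X ≫
          (shiftFunctorAdd C m n).hom.app (X⟦(1 : ℤ)⟧) ≫
            ((shiftFunctorComm C 1 m).hom.app X)⟦n⟧' ≫
              (shiftFunctorComm C 1 n).hom.app (X⟦m⟧) := by
      rw [← key]; simp
    rw [key']
    simp
    rw [← reassoc_of% key, ← Functor.map_comp_assoc]
    simp⟩

variable {R : Type w} [Ring R] (𝒜 : ℕ → AddSubgroup R) [GradedRing 𝒜]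

variable (C) in
/-- A central action of the graded ring `R` on `C`: a homomorphism of graded rings from `R` to the
graded center, given degree by degree. -/
structure CentralAction where
  toCenter : ∀ n : ℕ, 𝒜 n →+ gradedCenter C (n : ℤ)
  map_one : toCenter 0 ⟨1, SetLike.GradedOne.one_mem⟩ =
    gradedCenter.one ((0 : ℕ) : ℤ) Nat.cast_zero
  map_mul : ∀ (m n : ℕ) (r : 𝒜 m) (s : 𝒜 n),
    toCenter (m + n) ⟨r.1 * s.1, SetLike.GradedMul.mul_mem r.2 s.2⟩ =
      gradedCenter.mul (toCenter m r) (toCenter n s) (Nat.cast_add m n).symm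

namespace CentralAction

variable {𝒜} (α : CentralAction C 𝒜)

/-- `φ_X(r) : X ⟶ Σ^{d} X` for `r` homogeneous of degree `d`. -/
def phi (X : C) {d : ℕ} (r : 𝒜 d) : X ⟶ X⟦(d : ℤ)⟧ := (α.toCenter d r).1.app X

/-- The graded group `Hom^*(X,Y) = ⨁_{i ∈ ℤ} Hom(X, Σⁱ Y)`. -/
def HomStar (_ : CentralAction C 𝒜) (X Y : C) : Type v := ⨁ i : ℤ, ShiftedHom X Y i

instance (X Y : C) : AddCommGroup (α.HomStar X Y) :=
  inferInstanceAs (AddCommGroup (⨁ i : ℤ, ShiftedHom X Y i))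

/-- The inclusion of `Hom(X, Σⁱ Y)` into `Hom^*(X,Y)`. -/
def of (X Y : C) (i : ℤ) : ShiftedHom X Y i →+ α.HomStar X Y :=
  DirectSum.of (fun i : ℤ => ShiftedHom X Y i) i

/-- The component of degree `i` of an element of `Hom^*(X,Y)`. -/
def component {X Y : C} (f : α.HomStar X Y) (i : ℤ) : X ⟶ Y⟦i⟧ :=
  (show ⨁ i : ℤ, ShiftedHom X Y i from f) i

variable {α} in
lemma addHom_ext {X Y : C} {A : Type*} [AddCommMonoid A] {f g : α.HomStar X Y →+ A}
    (h : ∀ i (x : ShiftedHom X Y i), f (α.of X Y i x) = g (α.of X Y i x)) : f = g :=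
  DirectSum.addHom_ext h

lemma of_comp_eq {X Y Z : C} {a b c c' : ℤ} (f : ShiftedHom X Y a) (g : ShiftedHom Y Z b)
    (h : b + a = c) (h' : b + a = c') :
    α.of X Z c (f.comp g h) = α.of X Z c' (f.comp g h') := by
  subst h h'; rfl

/-- Left multiplication by a homogeneous element `r` of degree `d`: it sends
`g : X ⟶ Σⁱ Y` to `X ⟶ ΣⁱY ⟶ Σ^{d+i}Y`, first `g` and then `Σⁱ φ_Y(r)`. -/
def homLeftMul (X Y : C) {d : ℕ} (r : 𝒜 d) : α.HomStar X Y →+ α.HomStar X Y :=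
  DirectSum.toAddMonoid (β := fun i : ℤ => ShiftedHom X Y i) fun i : ℤ =>
    (α.of X Y ((d : ℤ) + i)).comp
      { toFun := fun g : ShiftedHom X Y i => g.comp (α.phi Y r) rfl
        map_zero' := ShiftedHom.zero_comp _ _ _ _
        map_add' := fun g g' => ShiftedHom.add_comp g g' _ _ }

lemma homLeftMul_of (X Y : C) {d : ℕ} (r : 𝒜 d) (i : ℤ) (g : ShiftedHom X Y i) :
    α.homLeftMul X Y r (α.of X Y i g) =
      α.of X Y ((d : ℤ) + i) (g.comp (α.phi Y r) rfl) :=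
  DirectSum.toAddMonoid_of (β := fun i : ℤ => ShiftedHom X Y i) _ i g

/-- Left multiplication by homogeneous elements of degree `d`, additive in the element. -/
def leftMul (X Y : C) (d : ℕ) : 𝒜 d →+ AddMonoid.End (α.HomStar X Y) where
  toFun r := α.homLeftMul X Y r
  map_zero' := by
    refine addHom_ext fun i x => (α.homLeftMul_of X Y 0 i x).trans ?_
    have h : α.phi Y (0 : 𝒜 d) = 0 := by simp [phi]
    rw [h, ShiftedHom.comp_zero, _root_.map_zero]
    rfl
  map_add' r s := by
    refine addHom_ext fun i x => (α.homLeftMul_of X Y (r + s) i x).trans ?_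
    have h : α.phi Y (r + s) = α.phi Y r + α.phi Y s := by simp [phi]
    rw [h, ShiftedHom.comp_add, _root_.map_add, ← homLeftMul_of, ← homLeftMul_of]
    rfl

lemma leftMul_of (X Y : C) (d : ℕ) (r : 𝒜 d) (i : ℤ) (g : ShiftedHom X Y i) :
    α.leftMul X Y d r (α.of X Y i g) =
      α.of X Y ((d : ℤ) + i) (g.comp (α.phi Y r) rfl) :=
  α.homLeftMul_of X Y r i g

/-- The action of `R` on `Hom^*(X,Y)` by left multiplication. -/
def toEnd (X Y : C) : R →+* AddMonoid.End (α.HomStar X Y) :=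
  (DirectSum.toSemiring (α.leftMul X Y)
    (by
      refine addHom_ext fun i x => ?_
      refine (α.leftMul_of X Y 0 _ i x).trans ?_
      change _ = α.of X Y i x
      have h1 : α.phi Y (GradedMonoid.GOne.one (A := fun i => 𝒜 i) : 𝒜 0) =
          ShiftedHom.mk₀ ((0 : ℕ) : ℤ) Nat.cast_zero (𝟙 Y) := by
        refine (congrArg (fun z : gradedCenter C ((0 : ℕ) : ℤ) => z.1.app Y) α.map_one).trans ?_
        exact (Category.id_comp _).symm
      rw [h1, α.of_comp_eq _ _ rfl (show ((0 : ℕ) : ℤ) + i = i by simp),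
        ShiftedHom.comp_mk₀_id])
    (by
      intro m n r s
      refine addHom_ext fun i x => ?_
      refine (α.leftMul_of X Y (m + n) _ i x).trans ?_
      refine Eq.trans ?_ (congrArg (α.leftMul X Y m r) (α.leftMul_of X Y n s i x)).symm
      rw [leftMul_of]
      have h1 : α.phi Y (GradedMonoid.GMul.mul (A := fun i => 𝒜 i) r s : 𝒜 (m + n)) =
          ShiftedHom.comp (X := Y) (Y := Y) (Z := Y) (α.phi Y s) (α.phi Y r)
            (Nat.cast_add m n).symm :=
        congrArg (fun z : gradedCenter C ((m + n : ℕ) : ℤ) => z.1.app Y) (α.map_mul m n r s)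
      rw [h1, ← ShiftedHom.comp_assoc x (α.phi Y s) (α.phi Y r) rfl (Nat.cast_add m n).symm
        (by push_cast; ring)]
      exact α.of_comp_eq _ _ _ _)).comp
  (DirectSum.decomposeRingEquiv 𝒜 : R ≃+* ⨁ i, 𝒜 i).toRingHom

instance (X Y : C) : Module R (α.HomStar X Y) := Module.compHom _ (α.toEnd X Y)

/-- On homogeneous elements the `R`-module structure is left multiplication via `φ_Y`. -/
lemma smul_of (X Y : C) (d : ℕ) (r : 𝒜 d) (i : ℤ) (g : ShiftedHom X Y i) :
    (r : R) • α.of X Y i g = α.of X Y ((d : ℤ) + i) (g.comp (α.phi Y r) rfl) := by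
  rw [← leftMul_of]
  change DirectSum.toAddMonoid (α.leftMul X Y) (DirectSum.decompose 𝒜 (r : R)) _ = _
  rw [DirectSum.decompose_coe, DirectSum.toAddMonoid_of]

lemma component_add {X Y : C} (f g : α.HomStar X Y) (i : ℤ) :
    α.component (f + g) i = α.component f i + α.component g i := rfl

lemma component_zero {X Y : C} (i : ℤ) : α.component (0 : α.HomStar X Y) i = 0 := rfl

lemma component_of_ne {X Y : C} {i j : ℤ} (g : ShiftedHom X Y i) (h : i ≠ j) :
    α.component (α.of X Y i g) j = 0 :=
  DirectSum.of_eq_of_ne _ _ _ h.symm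

lemma component_smul_eq_zero {X Y : C} {d : ℕ} (r : 𝒜 d) (f : α.HomStar X Y) (j : ℤ)
    (hf : ∀ i : ℤ, (d : ℤ) + i = j → α.component f i = 0) :
    α.component ((r : R) • f) j = 0 := by
  classical
  let ev (j : ℤ) : α.HomStar X Y →+ ShiftedHom X Y j :=
    { toFun := fun f => α.component f j, map_zero' := rfl, map_add' := fun _ _ => rfl }
  change ev j _ = 0
  have key : f = ∑ i ∈ DFinsupp.support (show ⨁ i : ℤ, ShiftedHom X Y i from f),
      α.of X Y i (α.component f i) :=
    (DirectSum.sum_support_of (show ⨁ i : ℤ, ShiftedHom X Y i from f)).symm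
  rw [key, Finset.smul_sum, map_sum]
  refine Finset.sum_eq_zero fun i _ => ?_
  rw [smul_of]
  by_cases h : (d : ℤ) + i = j
  · rw [hf i h, ShiftedHom.zero_comp, map_zero, map_zero]
  · exact α.component_of_ne _ h

/-- The `R`-submodule `Hom^{≥ n}(X,Y)` of `Hom^*(X,Y)`. -/
def homGE (X Y : C) (n : ℤ) : Submodule R (α.HomStar X Y) where
  carrier := {f | ∀ i : ℤ, i < n → α.component f i = 0}
  zero_mem' := fun _ _ => rfl
  add_mem' := by
    intro f g hf hg i hi
    rw [component_add, hf i hi, hg i hi, add_zero]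
  smul_mem' := by
    classical
    intro r f hf j hj
    let ev : α.HomStar X Y →+ ShiftedHom X Y j :=
      { toFun := fun f => α.component f j, map_zero' := rfl, map_add' := fun _ _ => rfl }
    change ev _ = 0
    rw [← DirectSum.sum_support_decompose 𝒜 r, Finset.sum_smul, map_sum]
    refine Finset.sum_eq_zero fun d _ => ?_
    exact α.component_smul_eq_zero _ f j fun i hi => hf i (by omega)

/-- `Hom(X, Σⁿ Y)` as a module over `R_0`, namely as the degree `n` part of `Hom^*(X,Y)`. -/
def homDegree (X Y : C) (n : ℤ) :
    Submodule (SetLike.GradeZero.subring 𝒜) (α.HomStar X Y) where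
  carrier := {f | ∀ i : ℤ, i ≠ n → α.component f i = 0}
  zero_mem' := fun _ _ => rfl
  add_mem' := by
    intro f g hf hg i hi
    rw [component_add, hf i hi, hg i hi, add_zero]
  smul_mem' := by
    intro r f hf j hj
    exact α.component_smul_eq_zero (d := 0) ⟨r.1, r.2⟩ f j
      fun i hi => hf i (by rintro rfl; simp at hi; exact hj hi.symm)

/-- `Hom^*(X,Y)` is an eventually Noetherian `R`-module. -/
def EventuallyNoetherian (X Y : C) : Prop :=
  ∃ n₀ : ℤ, IsNoetherian R (α.homGE X Y n₀)

/-- `Hom^*(X,Y)` is an eventually Noetherian `R`-module of finite length. -/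
def EventuallyNoetherianFL (X Y : C) : Prop :=
  α.EventuallyNoetherian X Y ∧
    ∃ n₀ : ℤ, ∀ n : ℤ, n₀ ≤ n →
      IsFiniteLength (SetLike.GradeZero.subring 𝒜) (α.homDegree X Y n)

/-- The complexity of the pair `(X,Y)`: the Krull dimension over `R^ev` of `Hom^{≥ n}(X,Y)` for
`n ≫ 0`. The dimension does not increase with `n`, so that its value for `n ≫ 0` is
the infimum over all `n`. The zero module is given dimension `0`. -/
def cxPair [IsGradedCommutative 𝒜] (X Y : C) : ℕ∞ :=
  ⨅ n : ℤ, (Module.supportDim (evenSubring 𝒜) (α.homGE X Y n)).unbotD 0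

/-- The complexity of the object `X`. -/
def cx [IsGradedCommutative 𝒜] (X : C) : ℕ∞ := α.cxPair X X

/-- `K` is a Koszul object `X//r`: there is a distinguished triangle
`X ⟶ Σ^{d} X ⟶ K ⟶ Σ X` whose first morphism is `φ_X(r)`. -/
def IsKoszulObject [HasZeroObject C] [Pretriangulated C] (X : C) {d : ℕ} (r : 𝒜 d) (K : C) :
    Prop :=
  ∃ (g : X⟦(d : ℤ)⟧ ⟶ K) (h : K ⟶ X⟦(1 : ℤ)⟧), Triangle.mk (α.phi X r) g h ∈ distTriang C

end CentralAction

end Center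

end

/-! Write `A` for the even subring, `A₊` for its irrelevant ideal, `M` for `Hom^{≥ n}(X,X)` with `n`
large, and `I` for the annihilator of `M` in `A`. A parity argument (`isNoetherian_evenSubring`)
makes `M` Noetherian over `A`, so `A ⧸ I` is Noetherian, `I` is homogeneous and `cx X = dim V(I)`.
Finite length of the graded pieces makes the degree-zero part zero-dimensional: every prime
containing `I` and `A₊` is maximal (`isMaximal_of_annihilator_le`).

Algebra (`exists_homogeneous_krullDim_drop`): by prime avoidance some homogeneous `r` of positive
degree lies outside all minimal primes of `I` not containing `A₊`, and then `dim V(I + (r)) < dim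
V(I)`. Parameters modulo `I + (r)` together with `r` make `A ⧸ I` finite over a polynomial ring over
a zero-dimensional ring, so the dimension is finite and, if at least 2, drops by at most one.

Triangles: let `K = X//r`. Fourth powers of homogeneous elements of `I` kill `Hom^{≥ m}(K,K)` for
large `m`, and `r²` acts as zero on `K`, so the support lies in `V(I + (r))`. Conversely, if a
homogeneous `b` of degree at least `|r|` has `φ_K(b) = 0`, then `bM ⊆ rM`, so `b` lies in every
prime of `Supp (M/rM) = V(I + (r))`. Hence a prime of `V(I + (r))` not containing `A₊` supports
every `Hom^{≥ m}(K,K)` (`IsKoszulObject.mem_support`). The remaining primes are maximal and do not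
affect a positive dimension; if `cx X = 1`, the upper bound alone suffices. -/

/-! ### Dimension theory of graded commutative rings with zero-dimensional degree-zero part -/

section GradedDimension

variable {A : Type*} [CommRing A] (ℬ : ℕ → AddSubgroup A) [GradedRing ℬ]

/-- Homogeneous prime avoidance for homogeneous primes. -/
lemma exists_homogeneous_notMem_of_isHomogeneous (n : ℕ) (s : Finset (Ideal A)) (hn : s.card = n)
    (hs : ∀ p ∈ s, p.IsPrime ∧ p.IsHomogeneous ℬ ∧
      ¬ (HomogeneousIdeal.irrelevant ℬ).toIdeal ≤ p) :
    ∃ d : ℕ, 0 < d ∧ ∃ r ∈ ℬ d, ∀ p ∈ s, r ∉ p := by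
  classical
  induction n generalizing s with
  | zero =>
    rw [Finset.card_eq_zero] at hn
    subst hn
    exact ⟨1, one_pos, 0, zero_mem _, by simp⟩
  | succ n ih =>
    by_cases hc : ∃ p ∈ s, ∃ q ∈ s, p ≠ q ∧ p ≤ q
    · obtain ⟨p, hp, q, hq, hne, hle⟩ := hc
      obtain ⟨d, hd, r, hr, h⟩ := ih (s.erase p) (by rw [Finset.card_erase_of_mem hp, hn]; rfl)
        fun p' hp' => hs p' (Finset.mem_of_mem_erase hp')
      refine ⟨d, hd, r, hr, fun p' hp' => ?_⟩
      by_cases h' : p' = p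
      · subst h'
        exact fun hm => h q (Finset.mem_erase.mpr ⟨hne.symm, hq⟩) (hle hm)
      · exact h p' (Finset.mem_erase.mpr ⟨h', hp'⟩)
    · push Not at hc
      obtain ⟨q, hq⟩ : s.Nonempty := by
        rw [← Finset.card_pos]; omega
      obtain ⟨hqp, hqh, hqi⟩ := hs q hq
      obtain ⟨d, hd, r, hr, h⟩ := ih (s.erase q) (by rw [Finset.card_erase_of_mem hq, hn]; rfl)
        fun p' hp' => hs p' (Finset.mem_of_mem_erase hp')
      by_cases hrq : r ∈ q
      swap
      · refine ⟨d, hd, r, hr, fun p hp => ?_⟩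
        by_cases h' : p = q
        · subst h'; exact hrq
        · exact h p (Finset.mem_erase.mpr ⟨h', hp⟩)
      obtain ⟨e, he, z, hz, hzq⟩ : ∃ e : ℕ, 0 < e ∧ ∃ z ∈ ℬ e, z ∉ q := by
        by_contra! hcon
        exact hqi ((HomogeneousIdeal.toIdeal_irrelevant_le ℬ).mpr fun i hi x hx => hcon i hi x hx)
      have hy : ∀ p ∈ s.erase q, ∃ (m : ℕ) (y : A), y ∈ ℬ m ∧ y ∈ p ∧ y ∉ q := by
        intro p hp
        have hps := Finset.mem_of_mem_erase hp
        obtain ⟨y, hyp, hyq⟩ := SetLike.not_le_iff_exists.mp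
          (hc p hps q hq (Finset.ne_of_mem_erase hp))
        by_contra! hcon
        refine hyq ((hqh.mem_iff).mpr fun i => ?_)
        exact hcon i _ (SetLike.coe_mem _) ((hs p hps).2.1 i hyp)
      choose! m y hym hyp hyq using hy
      set Y := ∏ p ∈ s.erase q, y p with hY
      have hYm : Y ∈ ℬ (∑ p ∈ s.erase q, m p) := SetLike.prod_mem_graded _ _ _ hym
      have hYq : Y ∉ q := fun hmem => by
        obtain ⟨p, hp, hpq⟩ := (hqp.prod_mem_iff).mp hmem
        exact hyq p hp hpq
      have hYp : ∀ p ∈ s.erase q, Y ∈ p := fun p hp =>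
        Ideal.mem_of_dvd p (Finset.dvd_prod_of_mem y hp) (hyp p hp)
      set M := e + ∑ p ∈ s.erase q, m p with hM
      have hzY : z * Y ∈ ℬ M := SetLike.mul_mem_graded hz hYm
      -- The exponents equalise the degrees. `r ^ M` lies in `q` and in no other member, `z * Y` in
      -- every other member but not in `q`, so the sum avoids all of them. The factor `z` keeps `M`
      -- positive.
      refine ⟨M * d, Nat.mul_pos (by omega) hd, r ^ M + (z * Y) ^ d, ?_, ?_⟩
      · refine add_mem ?_ ?_
        · simpa using SetLike.pow_mem_graded M hr
        · have := SetLike.pow_mem_graded d hzY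
          rwa [smul_eq_mul, mul_comm] at this
      · intro p hp hmem
        by_cases h' : p = q
        · subst h'
          have h2 : (z * Y) ^ d ∈ p :=
            (Ideal.add_mem_iff_right p (Ideal.pow_mem_of_mem p hrq M (by omega))).mp hmem
          rcases hqp.mem_or_mem (hqp.mem_of_pow_mem d h2) with h3 | h3
          exacts [hzq h3, hYq h3]
        · have hpe := Finset.mem_erase.mpr ⟨h', hp⟩
          have h2 : r ^ M ∈ p := (Ideal.add_mem_iff_left p
            (Ideal.pow_mem_of_mem p (Ideal.mul_mem_left p z (hYp p hpe)) d hd)).mp hmem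
          exact h p hpe ((hs p hp).1.mem_of_pow_mem M h2)

/-- Homogeneous prime avoidance. -/
lemma exists_homogeneous_notMem {s : Set (Ideal A)} (hfin : s.Finite)
    (hs : ∀ p ∈ s, p.IsPrime ∧ ¬ (HomogeneousIdeal.irrelevant ℬ).toIdeal ≤ p) :
    ∃ d : ℕ, 0 < d ∧ ∃ r ∈ ℬ d, ∀ p ∈ s, r ∉ p := by
  classical
  -- A homogeneous element of `p` lies in the homogeneous core of `p`, so it suffices to avoid the
  -- cores.
  obtain ⟨d, hd, r, hr, h⟩ := exists_homogeneous_notMem_of_isHomogeneous ℬ _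
    (hfin.toFinset.image fun p => (p.homogeneousCore ℬ).toIdeal) rfl (by
      intro q hq
      obtain ⟨p, hp, rfl⟩ := Finset.mem_image.mp hq
      obtain ⟨h1, h2⟩ := hs p (hfin.mem_toFinset.mp hp)
      exact ⟨h1.homogeneousCore, HomogeneousIdeal.isHomogeneous _,
        fun hle => h2 (hle.trans (Ideal.toIdeal_homogeneousCore_le ℬ p))⟩)
  refine ⟨d, hd, r, hr, fun p hp hmem => ?_⟩
  exact h _ (Finset.mem_image.mpr ⟨p, hfin.mem_toFinset.mpr hp, rfl⟩)
    (Ideal.mem_homogeneousCore_of_homogeneous_of_mem ⟨d, hr⟩ hmem)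

/-- If `r` lies in no minimal prime of `J` that omits some element of positive degree, and
primes above `J` and the irrelevant ideal are maximal, then adding `r` lowers the dimension. -/
lemma krullDim_zeroLocus_sup_span_add_one_le {J : Ideal A} {r : A}
    (hmax : ∀ p : Ideal A, p.IsPrime → J ≤ p →
      (HomogeneousIdeal.irrelevant ℬ).toIdeal ≤ p → p.IsMaximal)
    (hr : ∀ p ∈ J.minimalPrimes, ¬ (HomogeneousIdeal.irrelevant ℬ).toIdeal ≤ p → r ∉ p)
    (hJ : 1 ≤ Order.krullDim (PrimeSpectrum.zeroLocus (J : Set A))) :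
    Order.krullDim (PrimeSpectrum.zeroLocus ((J ⊔ Ideal.span {r} : Ideal A) : Set A)) + 1 ≤
      Order.krullDim (PrimeSpectrum.zeroLocus (J : Set A)) := by
  have key : ∀ l : LTSeries (PrimeSpectrum.zeroLocus ((J ⊔ Ideal.span {r} : Ideal A) : Set A)),
      ((l.length + 1 : ℕ) : WithBot ℕ∞) ≤
        Order.krullDim (PrimeSpectrum.zeroLocus (J : Set A)) := by
    intro l
    let ι : PrimeSpectrum.zeroLocus ((J ⊔ Ideal.span {r} : Ideal A) : Set A) →
        PrimeSpectrum.zeroLocus (J : Set A) :=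
      fun p => ⟨p.1, PrimeSpectrum.zeroLocus_anti_mono
        (show (J : Set A) ⊆ _ from (le_sup_left : J ≤ J ⊔ Ideal.span {r})) p.2⟩
    have hι : StrictMono ι := fun a b h => h
    have hJl : J ⊔ Ideal.span {r} ≤ l.head.1.asIdeal := l.head.2
    have hJ' : J ≤ l.head.1.asIdeal := le_sup_left.trans hJl
    have hrl : r ∈ l.head.1.asIdeal := hJl (Ideal.mem_sup_right (Ideal.mem_span_singleton_self r))
    obtain ⟨q, hq, hql⟩ := Ideal.exists_minimalPrimes_le hJ'
    -- If `q` is strictly below the head, it lengthens the chain. Otherwise the head is minimal over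
    -- `J` and contains `r`, so it contains the irrelevant ideal and is maximal; the chain has
    -- length 0 and `hJ` suffices.
    by_cases hqe : q = l.head.1.asIdeal
    · have hirr : (HomogeneousIdeal.irrelevant ℬ).toIdeal ≤ q := by
        by_contra hcon
        exact hr q hq hcon (hqe ▸ hrl)
      have hqm := hmax q hq.1.1 hq.1.2 hirr
      have hl : l.length = 0 := by
        by_contra hlen
        have hlt : l.head < l.last := l.strictMono (by
          rw [Fin.lt_def]; simp; omega)
        have hlt' : l.head.1.asIdeal < l.last.1.asIdeal := hlt
        rw [← hqe] at hlt'
        exact l.last.1.isPrime.ne_top (hqm.1.2 _ hlt')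
      rw [hl]
      simpa using hJ
    · let l' := (l.map ι hι).cons ⟨⟨q, hq.1.1⟩, hq.1.2⟩ (by
        change q < l.head.1.asIdeal
        exact lt_of_le_of_ne hql hqe)
      have := Order.LTSeries.length_le_krullDim l'
      simpa [l'] using this
  rcases eq_or_ne (Order.krullDim (PrimeSpectrum.zeroLocus (J : Set A))) ⊤ with h | h
  · rw [h]; exact le_top
  obtain ⟨m, hm⟩ : ∃ m : ℕ, Order.krullDim (PrimeSpectrum.zeroLocus (J : Set A)) = m := by
    generalize Order.krullDim (PrimeSpectrum.zeroLocus (J : Set A)) = D at *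
    induction D using WithBot.recBotCoe with
    | bot => simp at hJ
    | coe D =>
      induction D using ENat.recTopCoe with
      | top => exact absurd rfl h
      | coe m => exact ⟨m, rfl⟩
  rw [hm] at key hJ ⊢
  have h1 : 1 ≤ m := by exact_mod_cast hJ
  have : Order.krullDim (PrimeSpectrum.zeroLocus ((J ⊔ Ideal.span {r} : Ideal A) : Set A)) ≤
      ((m - 1 : ℕ) : WithBot ℕ∞) := by
    refine iSup_le fun l => ?_
    have := key l
    have h2 : l.length + 1 ≤ m := by exact_mod_cast this
    have h3 : l.length ≤ m - 1 := by omega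
    exact_mod_cast h3
  calc _ ≤ ((m - 1 : ℕ) : WithBot ℕ∞) + 1 := by gcongr
    _ = ((m - 1 + 1 : ℕ) : WithBot ℕ∞) := by push_cast; rfl
    _ = m := by rw [Nat.sub_add_cancel h1]

/-- A homogeneous ideal contained in a prime omitting some element of positive degree has
positive dimension. -/
lemma one_le_krullDim_zeroLocus {J : Ideal A} (hJ : J.IsHomogeneous ℬ) {p : Ideal A}
    (hp : p.IsPrime) (hJp : J ≤ p) (hirr : ¬ (HomogeneousIdeal.irrelevant ℬ).toIdeal ≤ p) :
    1 ≤ Order.krullDim (PrimeSpectrum.zeroLocus (J : Set A)) := by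
  set q := (p.homogeneousCore ℬ).toIdeal with hq
  have hqp : q.IsPrime := hp.homogeneousCore
  have hqle : q ≤ p := Ideal.toIdeal_homogeneousCore_le ℬ p
  have hqh : q.IsHomogeneous ℬ := HomogeneousIdeal.isHomogeneous _
  have hJq : J ≤ q := by
    rw [← hJ.toIdeal_homogeneousCore_eq_self]
    exact Ideal.homogeneousCore_mono ℬ hJp
  -- If `1 = x + y`, the degree-zero component of `x` is 1 and lies in the homogeneous ideal `q`. A
  -- maximal ideal above the sum is then strictly larger than `q`.
  have hne : q ⊔ (HomogeneousIdeal.irrelevant ℬ).toIdeal ≠ ⊤ := by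
    intro htop
    obtain ⟨x, hx, y, hy, hxy⟩ := Submodule.mem_sup.mp
      ((Ideal.eq_top_iff_one _).mp htop)
    have h0 := congrArg (GradedRing.proj ℬ 0) hxy
    rw [map_add, (HomogeneousIdeal.mem_irrelevant_iff ℬ y).mp hy, add_zero,
      GradedRing.proj_apply, GradedRing.proj_apply,
      DirectSum.decompose_of_mem_same ℬ SetLike.GradedOne.one_mem] at h0
    exact hqp.ne_top ((Ideal.eq_top_iff_one _).mpr (h0 ▸ hqh 0 hx))
  obtain ⟨m, hm, hle⟩ := Ideal.exists_le_maximal _ hne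
  have hlt : q < m := lt_of_le_of_ne (le_sup_left.trans hle) fun h =>
    hirr ((h ▸ le_sup_right.trans hle).trans hqle)
  let a : PrimeSpectrum.zeroLocus (J : Set A) := ⟨⟨q, hqp⟩, hJq⟩
  let b : PrimeSpectrum.zeroLocus (J : Set A) := ⟨⟨m, hm.isPrime⟩, hJq.trans hlt.le⟩
  have hab : a < b := hlt
  let l : LTSeries (PrimeSpectrum.zeroLocus (J : Set A)) :=
    (RelSeries.singleton _ b).cons a hab
  have hl : l.length = 1 := rfl
  have := Order.LTSeries.length_le_krullDim l
  rw [hl] at this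
  exact_mod_cast this

lemma finite_minimalPrimes_of_quotient {I J : Ideal A} [IsNoetherianRing (A ⧸ I)] (hIJ : I ≤ J) :
    J.minimalPrimes.Finite := by
  have : IsNoetherianRing (A ⧸ J) :=
    isNoetherianRing_of_surjective _ _ (Ideal.Quotient.factor hIJ)
      (Ideal.Quotient.factor_surjective hIJ)
  rw [Ideal.minimalPrimes_eq_comap]
  exact (minimalPrimes.finite_of_isNoetherianRing _).image _

/-- A parameter that lowers the dimension. -/
lemma exists_parameter {I J : Ideal A} [IsNoetherianRing (A ⧸ I)] (hIJ : I ≤ J)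
    (hmax : ∀ p : Ideal A, p.IsPrime → I ≤ p →
      (HomogeneousIdeal.irrelevant ℬ).toIdeal ≤ p → p.IsMaximal)
    (hJ : 1 ≤ Order.krullDim (PrimeSpectrum.zeroLocus (J : Set A))) :
    ∃ d : ℕ, 0 < d ∧ ∃ r ∈ ℬ d,
      (∀ p ∈ J.minimalPrimes, ¬ (HomogeneousIdeal.irrelevant ℬ).toIdeal ≤ p → r ∉ p) ∧
      Order.krullDim (PrimeSpectrum.zeroLocus ((J ⊔ Ideal.span {r} : Ideal A) : Set A)) + 1 ≤
        Order.krullDim (PrimeSpectrum.zeroLocus (J : Set A)) := by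
  obtain ⟨d, hd, r, hr, h⟩ := exists_homogeneous_notMem ℬ
    (s := {p ∈ J.minimalPrimes | ¬ (HomogeneousIdeal.irrelevant ℬ).toIdeal ≤ p})
    ((finite_minimalPrimes_of_quotient hIJ).subset (Set.sep_subset _ _))
    (fun p hp => ⟨hp.1.1.1, hp.2⟩)
  have h' : ∀ p ∈ J.minimalPrimes, ¬ (HomogeneousIdeal.irrelevant ℬ).toIdeal ≤ p → r ∉ p :=
    fun p hp hp' => h p ⟨hp, hp'⟩
  exact ⟨d, hd, r, hr, h', krullDim_zeroLocus_sup_span_add_one_le ℬ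
    (fun p hp hle => hmax p hp (hIJ.trans hle)) h' hJ⟩

/-- Existence of homogeneous systems of parameters. -/
lemma exists_system_of_parameters {I : Ideal A} [hN : IsNoetherianRing (A ⧸ I)]
    (hmax : ∀ p : Ideal A, p.IsPrime → I ≤ p →
      (HomogeneousIdeal.irrelevant ℬ).toIdeal ≤ p → p.IsMaximal)
    (J : Ideal A) (hIJ : I ≤ J) (hJ : J.IsHomogeneous ℬ) :
    ∃ (k : ℕ) (t : Fin k → A), (∀ i, ∃ d : ℕ, 0 < d ∧ t i ∈ ℬ d) ∧
      (∀ p : Ideal A, p.IsPrime → J ≤ p → (∀ i, t i ∈ p) →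
        (HomogeneousIdeal.irrelevant ℬ).toIdeal ≤ p) ∧
      (k = 0 ∨ (k : WithBot ℕ∞) ≤ Order.krullDim (PrimeSpectrum.zeroLocus (J : Set A))) := by
  have hw : WellFoundedGT (Ideal (A ⧸ I)) := inferInstanceAs (WellFoundedGT (Submodule _ _))
  -- Noetherian induction runs on the image of `J` in `A ⧸ I`, since `A` itself need not be
  -- Noetherian.
  obtain ⟨L, hL⟩ : ∃ L, L = J.map (Ideal.Quotient.mk I) := ⟨_, rfl⟩
  induction L using WellFoundedGT.induction generalizing J with
  | ind L ih =>
    by_cases hall : ∀ p : Ideal A, p.IsPrime → J ≤ p →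
        (HomogeneousIdeal.irrelevant ℬ).toIdeal ≤ p
    -- The alternative `k = 0` is kept apart because the zero locus may be empty, of dimension `⊥`.
    · exact ⟨0, Fin.elim0, fun i => i.elim0, fun p hp hle _ => hall p hp hle, Or.inl rfl⟩
    push Not at hall
    obtain ⟨p, hp, hJp, hirr⟩ := hall
    have h1 := one_le_krullDim_zeroLocus ℬ hJ hp hJp hirr
    obtain ⟨d, hd, r, hr, havoid, hdim⟩ := exists_parameter ℬ hIJ hmax h1
    have hrJ : r ∉ J := by
      obtain ⟨q, hq, hqp⟩ := Ideal.exists_minimalPrimes_le hJp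
      exact fun h => havoid q hq (fun hle => hirr (hle.trans hqp)) (hq.1.2 h)
    have hlt : J.map (Ideal.Quotient.mk I) < (J ⊔ Ideal.span {r}).map (Ideal.Quotient.mk I) := by
      refine lt_of_le_of_ne (Ideal.map_mono le_sup_left) fun heq => hrJ ?_
      have h2 : Ideal.Quotient.mk I r ∈ J.map (Ideal.Quotient.mk I) := by
        rw [heq]
        exact Ideal.mem_map_of_mem _ (Ideal.mem_sup_right (Ideal.mem_span_singleton_self r))
      rwa [← Ideal.mem_comap, Ideal.comap_map_of_surjective _ Ideal.Quotient.mk_surjective,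
        ← RingHom.ker_eq_comap_bot, Ideal.mk_ker, sup_eq_left.mpr hIJ] at h2
    obtain ⟨k, t, ht, htp, hk⟩ := ih _ (hL ▸ hlt) (J ⊔ Ideal.span {r}) (hIJ.trans le_sup_left)
      (hJ.sup (Ideal.homogeneous_span ℬ _ (by rintro x rfl; exact ⟨d, hr⟩))) rfl
    refine ⟨k + 1, Fin.cons r t, ?_, ?_, Or.inr ?_⟩
    · intro i
      refine Fin.cases ⟨d, hd, hr⟩ (fun j => ?_) i
      simpa using ht j
    · intro p' hp' hJp' hall'
      refine htp p' hp' (sup_le hJp' ?_) fun i => by simpa using hall' i.succ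
      rw [Ideal.span_singleton_le_iff_mem]
      simpa using hall' 0
    · rcases hk with rfl | hk
      · simpa using h1
      · refine le_trans ?_ hdim
        push_cast
        gcongr

/-- Incomparability for integral extensions makes contraction of primes strictly monotone; `f` need
not be injective. -/
lemma ringKrullDim_le_of_finite {S T : Type*} [CommRing S] [CommRing T] (f : S →+* T)
    (hf : f.Finite) : ringKrullDim T ≤ ringKrullDim S := by
  algebraize [f]
  have : Algebra.IsIntegral S T := Algebra.IsIntegral.of_finite S T
  refine Order.krullDim_le_of_strictMono (PrimeSpectrum.comap f) fun p q hpq => ?_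
  exact Ideal.IsIntegral.comap_lt_comap hpq

/-- Finite generation of `A ⧸ (I + A₊ ^ N)` over the degree-zero part. In the induction step,
generators `G` of `A₊ ^ N` modulo `I` are added; replacing their coefficients by degree-zero parts
costs an error in `A₊ * A₊ ^ N`. -/
lemma exists_finset_degreeZero_combination {I : Ideal A} [IsNoetherianRing (A ⧸ I)] (N : ℕ) :
    ∃ W : Finset A, ∀ a : A, ∃ c : A → A,
      a - ∑ w ∈ W, GradedRing.proj ℬ 0 (c w) * w ∈
        I ⊔ (HomogeneousIdeal.irrelevant ℬ).toIdeal ^ N := by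
  classical
  induction N with
  | zero => exact ⟨∅, fun a => ⟨0, by simp⟩⟩
  | succ N ih =>
    obtain ⟨W, hW⟩ := ih
    set P := (HomogeneousIdeal.irrelevant ℬ).toIdeal with hP
    obtain ⟨G, hGP, hG⟩ : ∃ G : Finset A, (G : Set A) ⊆ (P ^ N : Ideal A) ∧
        P ^ N ≤ I ⊔ Ideal.span G := by
      have hfg : (Submodule.span (A ⧸ I) (Ideal.Quotient.mk I '' (P ^ N : Ideal A))).FG :=
        IsNoetherian.noetherian _
      obtain ⟨s, hs, hspan⟩ := (Submodule.fg_span_iff_fg_span_finset_subset _).mp hfg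
      obtain ⟨G, hG, rfl⟩ := Finset.subset_set_image_iff.mp hs
      refine ⟨G, hG, fun y hy => ?_⟩
      have hy' : Ideal.Quotient.mk I y ∈ (Ideal.span (G : Set A)).map (Ideal.Quotient.mk I) := by
        rw [Ideal.map_span, ← Finset.coe_image]
        change _ ∈ Submodule.span _ _
        rw [← hspan]
        exact Submodule.subset_span ⟨y, hy, rfl⟩
      rwa [← Ideal.mem_comap, Ideal.comap_map_of_surjective _ Ideal.Quotient.mk_surjective,
        ← RingHom.ker_eq_comap_bot, Ideal.mk_ker, sup_comm] at hy'
    refine ⟨W ∪ G, fun a => ?_⟩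
    obtain ⟨c, hc⟩ := hW a
    obtain ⟨x, hx, y, hy, hxy⟩ := Submodule.mem_sup.mp (sup_le le_sup_left hG hc)
    obtain ⟨b, -, hb⟩ := Submodule.mem_span_finset.mp hy
    refine ⟨fun w => (if w ∈ W then c w else 0) + (if w ∈ G then b w else 0), ?_⟩
    have hsplit : ∑ w ∈ W ∪ G, GradedRing.proj ℬ 0
          ((if w ∈ W then c w else 0) + (if w ∈ G then b w else 0)) * w =
        ∑ w ∈ W, GradedRing.proj ℬ 0 (c w) * w + ∑ w ∈ G, GradedRing.proj ℬ 0 (b w) * w := by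
      simp only [map_add, add_mul, Finset.sum_add_distrib, apply_ite (GradedRing.proj ℬ 0),
        map_zero, ite_mul, zero_mul, Finset.sum_ite_mem]
      rw [Finset.inter_eq_right.mpr Finset.subset_union_left,
        Finset.inter_eq_right.mpr Finset.subset_union_right]
    rw [hsplit, ← sub_sub, ← hxy, ← hb, add_sub_assoc, ← Finset.sum_sub_distrib]
    refine add_mem (Ideal.mem_sup_left hx) (Ideal.mem_sup_right (sum_mem fun w hw => ?_))
    rw [smul_eq_mul, ← sub_mul, pow_succ']
    refine Ideal.mul_mem_mul ?_ (hGP hw)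
    rw [hP, HomogeneousIdeal.mem_iff, HomogeneousIdeal.mem_irrelevant_iff, map_sub, sub_eq_zero]
    simp [GradedRing.proj_apply]

/-- If finitely many homogeneous elements of positive degree cut the zero locus of `I` down to that
of the irrelevant ideal, their number bounds the dimension of `A ⧸ I`. -/
lemma krullDim_zeroLocus_le_of_parameters {I : Ideal A} [IsNoetherianRing (A ⧸ I)]
    (hI : I.IsHomogeneous ℬ)
    (hmax : ∀ p : Ideal A, p.IsPrime → I ≤ p →
      (HomogeneousIdeal.irrelevant ℬ).toIdeal ≤ p → p.IsMaximal)
    {k : ℕ} (t : Fin k → A) (ht : ∀ i, ∃ d : ℕ, 0 < d ∧ t i ∈ ℬ d)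
    (htp : ∀ p : Ideal A, p.IsPrime → I ≤ p → (∀ i, t i ∈ p) →
        (HomogeneousIdeal.irrelevant ℬ).toIdeal ≤ p) :
    Order.krullDim (PrimeSpectrum.zeroLocus (I : Set A)) ≤ k := by
  classical
  let T : Ideal A := I ⊔ Ideal.span (Set.range t)
  have hpow : ∃ N : ℕ, (HomogeneousIdeal.irrelevant ℬ).toIdeal ^ N ≤ T := by
    have hrad : (HomogeneousIdeal.irrelevant ℬ).toIdeal ≤ T.radical := by
      rw [Ideal.radical_eq_sInf]
      refine le_sInf fun p hp => htp p hp.2 (le_sup_left.trans hp.1) fun i =>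
        hp.1 (Ideal.mem_sup_right (Ideal.subset_span ⟨i, rfl⟩))
    obtain ⟨N, hN⟩ := Ideal.exists_pow_le_of_le_radical_of_fg
      (I := (HomogeneousIdeal.irrelevant ℬ).toIdeal.map (Ideal.Quotient.mk I))
      (J := T.map (Ideal.Quotient.mk I))
      ((Ideal.map_mono hrad).trans (Ideal.map_radical_le _))
      (IsNoetherian.noetherian _)
    refine ⟨N, ?_⟩
    rw [← Ideal.map_pow, Ideal.map_le_iff_le_comap,
      Ideal.comap_map_of_surjective _ Ideal.Quotient.mk_surjective,
      ← RingHom.ker_eq_comap_bot, Ideal.mk_ker, sup_eq_left.mpr le_sup_left] at hN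
    exact hN
  obtain ⟨N, hN⟩ := hpow
  obtain ⟨W, hW⟩ := exists_finset_degreeZero_combination ℬ (I := I) N
  -- `Q` is the degree-zero part of `A ⧸ I`. Presenting it as a quotient of `A` by an ideal
  -- containing `I` and `A₊` makes it Noetherian and, by `hmax`, zero-dimensional.
  let g : A →+* A ⧸ I := (Ideal.Quotient.mk I).comp (GradedRing.projZeroRingHom ℬ)
  let Q := A ⧸ RingHom.ker g
  have hIg : I ≤ RingHom.ker g := fun x hx => by
    rw [RingHom.mem_ker]
    exact Ideal.Quotient.eq_zero_iff_mem.mpr (hI 0 hx)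
  have hirrg : (HomogeneousIdeal.irrelevant ℬ).toIdeal ≤ RingHom.ker g := fun x hx => by
    rw [RingHom.mem_ker]
    have h0 := (HomogeneousIdeal.mem_irrelevant_iff ℬ x).mp hx
    change Ideal.Quotient.mk I (GradedRing.proj ℬ 0 x) = 0
    rw [h0, map_zero]
  have hQN : IsNoetherianRing Q := isNoetherianRing_of_surjective _ _ (Ideal.Quotient.factor hIg)
      (Ideal.Quotient.factor_surjective hIg)
  have hQ0 : ringKrullDim Q ≤ 0 := by
    have : Ring.KrullDimLE 0 Q := Ring.KrullDimLE.mk₀ fun p hp => by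
      have hc : (p.comap (Ideal.Quotient.mk (RingHom.ker g))).IsMaximal := by
        have hle : RingHom.ker g ≤ p.comap (Ideal.Quotient.mk (RingHom.ker g)) := by
          intro x hx
          rw [Ideal.mem_comap, Ideal.Quotient.eq_zero_iff_mem.mpr hx]
          exact p.zero_mem
        exact hmax _ (hp.comap _) (hIg.trans hle) (hirrg.trans hle)
      have := hc.map_of_surjective_of_ker_le (f := Ideal.Quotient.mk (RingHom.ker g))
        Ideal.Quotient.mk_surjective (Ideal.ker_le_comap _)
      rwa [Ideal.map_comap_of_surjective _ Ideal.Quotient.mk_surjective] at this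
    exact Order.krullDimLE_iff 0 _ |>.mp this
  let f : MvPolynomial (Fin k) Q →+* A ⧸ I :=
    MvPolynomial.eval₂Hom (RingHom.kerLift g) fun i => Ideal.Quotient.mk I (t i)
  have hf : f.Finite := by
    let _ := f.toAlgebra
    let W' : Set (A ⧸ I) := ⋃ w ∈ W, ⋃ j ∈ DFinsupp.support (decompose ℬ w),
      {Ideal.Quotient.mk I (decompose ℬ w j : A)}
    have hW' : W'.Finite := W.finite_toSet.biUnion fun w _ =>
      (Finset.finite_toSet _).biUnion fun j _ => Set.finite_singleton _
    let S := Submodule.span (MvPolynomial (Fin k) Q) W'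
    -- Graded Nakayama: modulo `I`, an element of degree `j` is a degree-zero combination of
    -- components of `W` plus multiples of the `t i`, whose cofactors have degree below `j` because
    -- the `t i` have positive degree.
    have hhom : ∀ (j : ℕ) (a : A), a ∈ ℬ j → Ideal.Quotient.mk I a ∈ S := by
      intro j
      induction j using Nat.strong_induction_on with
      | _ j ih =>
        intro a ha
        obtain ⟨c, hc⟩ := hW a
        have hc' : a - ∑ w ∈ W, GradedRing.proj ℬ 0 (c w) * w ∈ T :=
          sup_le le_sup_left hN hc
        obtain ⟨x, hx, y, hy, hxy⟩ := Submodule.mem_sup.mp hc'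
        obtain ⟨e, rfl⟩ := Ideal.mem_span_range_iff_exists_fun.mp hy
        have hda : GradedRing.proj ℬ j a = a := by
          rw [GradedRing.proj_apply, DirectSum.decompose_of_mem_same ℬ ha]
        have hsum : a = GradedRing.proj ℬ j x + ∑ i, GradedRing.proj ℬ j (e i * t i) +
            ∑ w ∈ W, GradedRing.proj ℬ j (GradedRing.proj ℬ 0 (c w) * w) := by
          rw [← map_sum, ← map_sum, ← map_add, ← map_add, hxy, sub_add_cancel, hda]
        rw [hsum, map_add, map_add, map_sum, map_sum]
        refine add_mem (add_mem ?_ (sum_mem fun i _ => ?_)) (sum_mem fun w hw => ?_)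
        · rw [GradedRing.proj_apply, Ideal.Quotient.eq_zero_iff_mem.mpr (hI j hx)]
          exact zero_mem _
        · obtain ⟨d, hd, htd⟩ := ht i
          rw [GradedRing.proj_apply, mul_comm]
          by_cases hdj : d ≤ j
          · rw [DirectSum.coe_decompose_mul_of_left_mem_of_le ℬ htd hdj, map_mul]
            have h2 := S.smul_mem (MvPolynomial.X i)
              (ih (j - d) (by omega) _ (SetLike.coe_mem (decompose ℬ (e i) (j - d))))
            have h3 : f (MvPolynomial.X i) = Ideal.Quotient.mk I (t i) := by simp [f]
            rwa [Algebra.smul_def, RingHom.algebraMap_toAlgebra, h3] at h2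
          · rw [DirectSum.coe_decompose_mul_of_left_mem_of_not_le ℬ htd hdj, map_zero]
            exact zero_mem _
        · have h0 : GradedRing.proj ℬ 0 (c w) ∈ ℬ 0 := SetLike.coe_mem _
          have h1 := DirectSum.coe_decompose_mul_of_left_mem_of_le ℬ (b := w) h0 (Nat.zero_le j)
          rw [GradedRing.proj_apply ℬ j, h1, map_mul, Nat.sub_zero]
          by_cases hz : decompose ℬ w j = 0
          · rw [hz]; simp
          have h2 : Ideal.Quotient.mk I (decompose ℬ w j : A) ∈ S :=
            Submodule.subset_span (Set.mem_biUnion hw (Set.mem_biUnion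
              (Finset.mem_coe.mpr (DFinsupp.mem_support_iff.mpr hz)) rfl))
          have h2 := S.smul_mem (MvPolynomial.C (Ideal.Quotient.mk _ (c w))) h2
          have h3 : f (MvPolynomial.C (Ideal.Quotient.mk _ (c w))) =
              Ideal.Quotient.mk I (GradedRing.proj ℬ 0 (c w)) := by
            simp only [f, MvPolynomial.eval₂Hom_C]
            rfl
          rwa [Algebra.smul_def, RingHom.algebraMap_toAlgebra, h3] at h2
    refine ⟨⟨hW'.toFinset, ?_⟩⟩
    rw [Set.Finite.coe_toFinset, eq_top_iff]
    rintro z -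
    obtain ⟨a, rfl⟩ := Ideal.Quotient.mk_surjective z
    rw [← DirectSum.sum_support_decompose ℬ a, map_sum]
    exact sum_mem fun j _ => hhom j _ (SetLike.coe_mem _)
  rw [← ringKrullDim_quotient]
  refine (ringKrullDim_le_of_finite f hf).trans ?_
  rw [MvPolynomial.ringKrullDim_of_isNoetherianRing]
  calc _ ≤ (0 : WithBot ℕ∞) + _ := by gcongr
    _ = _ := by simp

/-- The dimension of a graded quotient whose degree-zero part is zero-dimensional is finite. -/
theorem krullDim_zeroLocus_ne_top {I : Ideal A} [IsNoetherianRing (A ⧸ I)]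
    (hI : I.IsHomogeneous ℬ)
    (hmax : ∀ p : Ideal A, p.IsPrime → I ≤ p →
      (HomogeneousIdeal.irrelevant ℬ).toIdeal ≤ p → p.IsMaximal) :
    Order.krullDim (PrimeSpectrum.zeroLocus (I : Set A)) ≠ ⊤ := by
  obtain ⟨k, t, ht, htp, -⟩ := exists_system_of_parameters ℬ hmax I le_rfl hI
  intro h
  have := krullDim_zeroLocus_le_of_parameters ℬ hI hmax t ht htp
  rw [h, top_le_iff] at this
  exact absurd (WithBot.coe_injective this) (ENat.natCast_ne_top k)

/-- There is a homogeneous element of positive degree that lowers the dimension by exactly one. -/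
theorem exists_homogeneous_krullDim_drop {I : Ideal A} [IsNoetherianRing (A ⧸ I)]
    (hI : I.IsHomogeneous ℬ)
    (hmax : ∀ p : Ideal A, p.IsPrime → I ≤ p →
      (HomogeneousIdeal.irrelevant ℬ).toIdeal ≤ p → p.IsMaximal)
    (h1 : 1 ≤ Order.krullDim (PrimeSpectrum.zeroLocus (I : Set A))) :
    ∃ d : ℕ, 0 < d ∧ ∃ r ∈ ℬ d,
      Order.krullDim (PrimeSpectrum.zeroLocus ((I ⊔ Ideal.span {r} : Ideal A) : Set A)) + 1 ≤
        Order.krullDim (PrimeSpectrum.zeroLocus (I : Set A)) ∧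
      (Order.krullDim (PrimeSpectrum.zeroLocus (I : Set A)) ≤ 1 ∨
        Order.krullDim (PrimeSpectrum.zeroLocus (I : Set A)) ≤
          Order.krullDim
            (PrimeSpectrum.zeroLocus ((I ⊔ Ideal.span {r} : Ideal A) : Set A)) + 1) := by
  obtain ⟨d, hd, r, hr, -, hdim⟩ := exists_parameter ℬ le_rfl hmax h1
  refine ⟨d, hd, r, hr, hdim, ?_⟩
  obtain ⟨k, t, ht, htp, hk⟩ := exists_system_of_parameters ℬ hmax (I ⊔ Ideal.span {r})
    le_sup_left (hI.sup (Ideal.homogeneous_span ℬ _ (by rintro x rfl; exact ⟨d, hr⟩)))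
  -- Parameters modulo `I + (r)`, with `r` added, are parameters modulo `I`.
  have hle : Order.krullDim (PrimeSpectrum.zeroLocus (I : Set A)) ≤ ((k + 1 : ℕ) : WithBot ℕ∞) := by
    refine krullDim_zeroLocus_le_of_parameters ℬ hI hmax (Fin.cons r t) ?_ ?_
    · intro i
      refine Fin.cases ⟨d, hd, hr⟩ (fun j => ?_) i
      simpa using ht j
    · intro p' hp' hJp' hall'
      refine htp p' hp' (sup_le hJp' ?_) fun i => by simpa using hall' i.succ
      rw [Ideal.span_singleton_le_iff_mem]
      simpa using hall' 0
  rcases hk with rfl | hk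
  · left; simpa using hle
  · right
    refine hle.trans ?_
    push_cast
    gcongr

end GradedDimension

noncomputable section

/-! ### The grading of the even subring -/

section EvenGrading

variable {R : Type w} [Ring R] (𝒜 : ℕ → AddSubgroup R) [GradedRing 𝒜]

lemma mem_evenSubring_of_mem {i : ℕ} (hi : Even i) {r : R} (hr : r ∈ 𝒜 i) : r ∈ evenSubring 𝒜 := by
  intro j hj
  refine DirectSum.decompose_of_mem_ne 𝒜 hr ?_
  rintro rfl
  exact (Nat.not_odd_iff_even.mpr hi) hj

/-- The grading of `R^ev` induced by that of `R`; its components of odd degree vanish. -/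
def evenGrading (i : ℕ) : AddSubgroup (evenSubring 𝒜) :=
  (𝒜 i).comap (evenSubring 𝒜).subtype.toAddMonoidHom

lemma mem_evenGrading {i : ℕ} {a : evenSubring 𝒜} : a ∈ evenGrading 𝒜 i ↔ (a : R) ∈ 𝒜 i := Iff.rfl

lemma decompose_mem_evenSubring {a : R} (ha : a ∈ evenSubring 𝒜) (i : ℕ) :
    (decompose 𝒜 a i : R) ∈ evenSubring 𝒜 := by
  rcases Nat.even_or_odd i with hi | hi
  · exact mem_evenSubring_of_mem 𝒜 hi (SetLike.coe_mem _)
  · rw [ha i hi]; exact zero_mem _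

lemma isInternal_evenGrading : DirectSum.IsInternal (evenGrading 𝒜) := by
  classical
  constructor
  · let F : (⨁ i, evenGrading 𝒜 i) →+ ⨁ i, 𝒜 i :=
      DirectSum.map fun i => (((evenSubring 𝒜).subtype.toAddMonoidHom).comp
        (evenGrading 𝒜 i).subtype).codRestrict (𝒜 i) fun x => x.2
    have hF : Function.Injective F := by
      refine (DirectSum.map_injective _).mpr fun i x y h => ?_
      exact Subtype.ext (Subtype.ext (congrArg (fun z : 𝒜 i => (z : R)) h))
    have hcomp : ∀ x, ((DirectSum.coeAddMonoidHom (evenGrading 𝒜) x : evenSubring 𝒜) : R) =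
        DirectSum.coeAddMonoidHom 𝒜 (F x) := by
      intro x
      induction x using DirectSum.induction_on with
      | zero => simp
      | of i x => simp [F, DirectSum.map_of]
      | add x y hx hy => simp only [map_add, Subring.coe_add, hx, hy]
    intro x y h
    apply hF
    apply (DirectSum.Decomposition.isInternal 𝒜).1
    rw [← hcomp, ← hcomp, h]
  · intro a
    refine ⟨∑ i ∈ DFinsupp.support (decompose 𝒜 (a : R)), DirectSum.of (fun i => evenGrading 𝒜 i) i
      ⟨⟨decompose 𝒜 (a : R) i, decompose_mem_evenSubring 𝒜 a.2 i⟩,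
        (mem_evenGrading 𝒜).mpr (SetLike.coe_mem (decompose 𝒜 (a : R) i))⟩, ?_⟩
    rw [map_sum]
    simp only [DirectSum.coeAddMonoidHom_of]
    apply Subtype.ext
    rw [AddSubmonoidClass.coe_finsetSum]
    exact DirectSum.sum_support_decompose 𝒜 (a : R)

instance : DirectSum.Decomposition (evenGrading 𝒜) :=
  (isInternal_evenGrading 𝒜).chooseDecomposition

instance [IsGradedCommutative 𝒜] : GradedRing (evenGrading 𝒜) where
  one_mem := SetLike.GradedOne.one_mem (A := 𝒜)
  mul_mem _ _ _ _ ha hb := SetLike.GradedMul.mul_mem (A := 𝒜) ha hb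

/-- Every element of `R` is the sum of an even element and homogeneous elements of odd degree. -/
lemma exists_even_add_odd (r : R) : ∃ (a : evenSubring 𝒜) (s : Finset ℕ),
    (∀ i ∈ s, Odd i) ∧ r = a + ∑ i ∈ s, (decompose 𝒜 r i : R) := by
  classical
  refine ⟨⟨∑ i ∈ (DFinsupp.support (decompose 𝒜 r)).filter Even, (decompose 𝒜 r i : R),
    sum_mem fun i hi => mem_evenSubring_of_mem 𝒜 (Finset.mem_filter.mp hi).2 (SetLike.coe_mem _)⟩,
    (DFinsupp.support (decompose 𝒜 r)).filter fun i => ¬ Even i, fun i hi => ?_, ?_⟩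
  · exact Nat.not_even_iff_odd.mp (Finset.mem_filter.mp hi).2
  · change r = ∑ i ∈ _, _ + _
    rw [Finset.sum_filter_add_sum_filter_not, DirectSum.sum_support_decompose]

end EvenGrading

/-! ### Graded modules of morphisms over the even subring -/

namespace CentralAction

variable {C : Type u} [Category.{v} C] [Preadditive C] [HasShift C ℤ]
  [∀ n : ℤ, (shiftFunctor C n).Additive]
  {R : Type w} [Ring R] {𝒜 : ℕ → AddSubgroup R} [GradedRing 𝒜] (α : CentralAction C 𝒜)

/-- The component of degree `j`, as an additive map. -/
def componentHom (X Y : C) (j : ℤ) : α.HomStar X Y →+ ShiftedHom X Y j where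
  toFun f := α.component f j
  map_zero' := rfl
  map_add' _ _ := rfl

lemma component_of_self {X Y : C} (i : ℤ) (g : ShiftedHom X Y i) :
    α.component (α.of X Y i g) i = g :=
  DirectSum.of_eq_same _ _

lemma hom_ext {X Y : C} {f g : α.HomStar X Y} (h : ∀ i, α.component f i = α.component g i) :
    f = g := DFinsupp.ext h

open Classical in
/-- The degrees in which an element of `Hom^*(X,Y)` is nonzero. -/
def degrees {X Y : C} (f : α.HomStar X Y) : Finset ℤ :=
  DFinsupp.support (show ⨁ i : ℤ, ShiftedHom X Y i from f)

lemma sum_of_component {X Y : C} (f : α.HomStar X Y) :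
    ∑ i ∈ α.degrees f, α.of X Y i (α.component f i) = f := by
  classical
  exact DirectSum.sum_support_of (show ⨁ i : ℤ, ShiftedHom X Y i from f)

lemma of_mem_homGE {X Y : C} {n i : ℤ} (hi : n ≤ i) (g : ShiftedHom X Y i) :
    α.of X Y i g ∈ α.homGE X Y n :=
  fun _ hj => α.component_of_ne g (by omega)

lemma of_component_mem_homGE {X Y : C} {n : ℤ} {f : α.HomStar X Y} (hf : f ∈ α.homGE X Y n)
    (i : ℤ) : α.of X Y i (α.component f i) ∈ α.homGE X Y n := by
  by_cases hi : n ≤ i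
  · exact α.of_mem_homGE hi _
  · rw [hf i (by omega), map_zero]; exact zero_mem _

lemma homGE_anti (X Y : C) {m n : ℤ} (h : m ≤ n) : α.homGE X Y n ≤ α.homGE X Y m :=
  fun _ hf i hi => hf i (by omega)

/-- If an even element annihilates a homogeneous morphism, so do its homogeneous components. -/
lemma decompose_smul_of_eq_zero {X Y : C} {a : evenSubring 𝒜} {i : ℤ} {g : ShiftedHom X Y i}
    (h : a • α.of X Y i g = 0) (j : ℕ) :
    (decompose (evenGrading 𝒜) a j : evenSubring 𝒜) • α.of X Y i g = 0 := by
  classical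
  have hcomp (k : ℕ) (l : ℤ) (hl : (k : ℤ) + i ≠ l) :
      α.component ((decompose (evenGrading 𝒜) a k : evenSubring 𝒜) • α.of X Y i g) l = 0 := by
    refine α.component_smul_eq_zero (d := k) ⟨_, (decompose (evenGrading 𝒜) a k).2⟩ _ l
      fun m hm => α.component_of_ne g ?_
    omega
  refine α.hom_ext fun l => ?_
  by_cases hl : (j : ℤ) + i = l
  swap
  · rw [hcomp j l hl]; rfl
  have h' := congrArg (α.componentHom X Y l) h
  rw [map_zero] at h'
  rw [← DirectSum.sum_support_decompose (evenGrading 𝒜) a, Finset.sum_smul, map_sum] at h'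
  change _ = α.componentHom X Y l 0
  rw [map_zero, ← h']
  symm
  refine Finset.sum_eq_single (M := ShiftedHom X Y l) j (fun k _ hk => hcomp k l (by omega))
    fun hj => ?_
  rw [DFinsupp.notMem_support_iff.mp hj]
  simp

section Annihilator

variable [IsGradedCommutative 𝒜]

lemma mem_annihilator_homGE {X Y : C} {n : ℤ} {a : evenSubring 𝒜} :
    a ∈ Module.annihilator (evenSubring 𝒜) (α.homGE X Y n) ↔
      ∀ i, n ≤ i → ∀ g : ShiftedHom X Y i, a • α.of X Y i g = 0 := by
  rw [Module.mem_annihilator]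
  constructor
  · intro h i hi g
    exact congrArg Subtype.val (h ⟨_, α.of_mem_homGE hi g⟩)
  · rintro h ⟨f, hf⟩
    apply Subtype.ext
    change a • f = 0
    rw [← α.sum_of_component f, Finset.smul_sum]
    refine Finset.sum_eq_zero fun i _ => ?_
    by_cases hi : n ≤ i
    · exact h i hi _
    · rw [hf i (by omega), map_zero, smul_zero]

/-- Annihilation can be tested on homogeneous morphisms, where the components of `a` produce results
in distinct degrees and so must vanish separately. -/
lemma isHomogeneous_annihilator (X Y : C) (n : ℤ) :
    (Module.annihilator (evenSubring 𝒜) (α.homGE X Y n)).IsHomogeneous (evenGrading 𝒜) := by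
  intro j a ha
  rw [mem_annihilator_homGE] at ha ⊢
  exact fun i hi g => α.decompose_smul_of_eq_zero (ha i hi g) j

end Annihilator

/-- The elements of `Hom^*(X,Y)` concentrated in degrees congruent to `ε` modulo `2`. -/
def parityPart (X Y : C) (ε : ℤ) : Submodule (evenSubring 𝒜) (α.HomStar X Y) where
  carrier := {f | ∀ i : ℤ, ¬ Even (i + ε) → α.component f i = 0}
  zero_mem' := fun _ _ => rfl
  add_mem' := by
    intro f g hf hg i hi
    rw [component_add, hf i hi, hg i hi, add_zero]
  smul_mem' := by
    classical
    intro a f hf j hj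
    change α.componentHom X Y j ((a : R) • f) = 0
    rw [← DirectSum.sum_support_decompose 𝒜 (a : R), Finset.sum_smul, map_sum]
    refine Finset.sum_eq_zero fun d _ => ?_
    rcases Nat.even_or_odd d with hd | hd
    · refine α.component_smul_eq_zero _ f j fun i hi => hf i fun hi' => hj ?_
      rw [← hi, add_assoc]
      exact ((Int.even_coe_nat d).mpr hd).add hi'
    · rw [a.2 d hd, zero_smul, map_zero]

lemma odd_smul_mem_parityPart {X Y : C} {ε : ℤ} {d : ℕ} (hd : Odd d) (r : 𝒜 d)
    {f : α.HomStar X Y} (hf : f ∈ α.parityPart X Y ε) :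
    (r : R) • f ∈ α.parityPart X Y (ε + 1) := by
  intro j hj
  refine α.component_smul_eq_zero r f j fun i hi => hf i fun hi' => hj ?_
  have hd' : Odd (d : ℤ) := (Int.odd_coe_nat d).mpr hd
  have : j + (ε + 1) = (i + ε) + ((d : ℤ) + 1) := by omega
  rw [this]
  exact hi'.add hd'.add_one

lemma eq_zero_of_mem_parityPart {X Y : C} {ε : ℤ} {f : α.HomStar X Y}
    (h : f ∈ α.parityPart X Y ε) (h' : f ∈ α.parityPart X Y (ε + 1)) : f = 0 := by
  refine α.hom_ext fun i => ?_
  by_cases hi : Even (i + ε)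
  · exact h' i (by rw [← add_assoc, Int.not_even_iff_odd]; exact hi.add_one)
  · exact h i hi

/-- Split the coefficients into even and odd parts. The odd contribution has the opposite parity,
yet it is a difference of two elements of parity `ε`, so it vanishes. -/
lemma mem_of_mem_span_of_parity {X Y : C} {ε : ℤ} {N : Submodule (evenSubring 𝒜) (α.HomStar X Y)}
    (hN : N ≤ α.parityPart X Y ε) {t : Finset (α.HomStar X Y)} (ht : ∀ y ∈ t, y ∈ N)
    {x : α.HomStar X Y} (hx : x ∈ Submodule.span R (t : Set (α.HomStar X Y)))
    (hxε : x ∈ α.parityPart X Y ε) : x ∈ N := by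
  obtain ⟨c, -, rfl⟩ := Submodule.mem_span_finset.mp hx
  choose a s hs hc using fun y => exists_even_add_odd 𝒜 (c y)
  have h1 : ∑ y ∈ t, a y • y ∈ N := sum_mem fun y hy => N.smul_mem _ (ht y hy)
  have hsplit : ∑ y ∈ t, c y • y = ∑ y ∈ t, a y • y +
      ∑ y ∈ t, ∑ i ∈ s y, (decompose 𝒜 (c y) i : R) • y := by
    rw [← Finset.sum_add_distrib]
    refine Finset.sum_congr rfl fun y _ => ?_
    conv_lhs => rw [hc y, add_smul, Finset.sum_smul]
    rfl
  have h2 : ∑ y ∈ t, ∑ i ∈ s y, (decompose 𝒜 (c y) i : R) • y ∈ α.parityPart X Y (ε + 1) :=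
    sum_mem fun y hy => sum_mem fun i hi =>
      α.odd_smul_mem_parityPart (hs y i hi) _ (hN (ht y hy))
  have h3 : ∑ y ∈ t, ∑ i ∈ s y, (decompose 𝒜 (c y) i : R) • y ∈ α.parityPart X Y ε := by
    rw [hsplit] at hxε
    exact (Submodule.add_mem_iff_right _ (hN h1)).mp hxε
  rw [hsplit, α.eq_zero_of_mem_parityPart h3 h2, add_zero]
  exact h1

/-- A Noetherian `R`-module `Hom^{≥ n}(X,Y)` is Noetherian over the even subring. -/
lemma isNoetherian_evenSubring {X Y : C} {n : ℤ} (h : IsNoetherian R (α.homGE X Y n)) :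
    IsNoetherian (evenSubring 𝒜) (α.homGE X Y n) := by
  classical
  let G : Submodule (evenSubring 𝒜) (α.HomStar X Y) :=
    (α.homGE X Y n).restrictScalars (evenSubring 𝒜)
  -- Generators of the `R`-span of `s` can be chosen in `s`; by the parity argument they already
  -- generate `s` over the even subring.
  have key (ε : ℤ) : IsNoetherian (evenSubring 𝒜)
      (G ⊓ α.parityPart X Y ε : Submodule (evenSubring 𝒜) (α.HomStar X Y)) := by
    rw [isNoetherian_submodule]
    intro s hs
    have hfg : (Submodule.span R (s : Set (α.HomStar X Y))).FG :=
      isNoetherian_submodule.mp h _ (Submodule.span_le.mpr fun x hx => (hs hx).1)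
    obtain ⟨t, hts, ht⟩ := (Submodule.fg_span_iff_fg_span_finset_subset _).mp hfg
    have hle : Submodule.span (evenSubring 𝒜) (t : Set (α.HomStar X Y)) ≤ s :=
      Submodule.span_le.mpr hts
    refine ⟨t, le_antisymm hle fun x hx => ?_⟩
    refine α.mem_of_mem_span_of_parity (ε := ε) (fun y hy => (hs (hle hy)).2)
      (fun y hy => Submodule.subset_span hy) ?_ (hs hx).2
    rw [← ht]
    exact Submodule.subset_span hx
  have hG : G = (G ⊓ α.parityPart X Y 0) ⊔ (G ⊓ α.parityPart X Y 1) := by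
    refine le_antisymm (fun f hf => ?_) (sup_le inf_le_left inf_le_left)
    rw [← α.sum_of_component f]
    refine sum_mem fun i _ => ?_
    rcases Int.even_or_odd i with hi | hi
    · refine Submodule.mem_sup_left ⟨α.of_component_mem_homGE hf i, fun j hj => ?_⟩
      exact α.component_of_ne _ (by rintro rfl; exact hj (by simpa using hi))
    · refine Submodule.mem_sup_right ⟨α.of_component_mem_homGE hf i, fun j hj => ?_⟩
      exact α.component_of_ne _ (by rintro rfl; exact hj hi.add_one)
  have := key 0
  have := key 1
  have hGN : IsNoetherian (evenSubring 𝒜) G := by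
    rw [hG]; infer_instance
  exact hGN

/-- Finite length of the graded pieces makes the primes above the annihilator and the irrelevant
ideal maximal. -/
lemma isMaximal_of_annihilator_le [IsGradedCommutative 𝒜] {X Y : C} {n : ℤ}
    (hfin : Module.Finite (evenSubring 𝒜) (α.homGE X Y n))
    (hlen : ∀ i, n ≤ i → IsFiniteLength (SetLike.GradeZero.subring 𝒜) (α.homDegree X Y i))
    {p : Ideal (evenSubring 𝒜)} (hp : p.IsPrime)
    (hann : Module.annihilator (evenSubring 𝒜) (α.homGE X Y n) ≤ p)
    (hirr : (HomogeneousIdeal.irrelevant (evenGrading 𝒜)).toIdeal ≤ p) : p.IsMaximal := by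
  classical
  obtain ⟨S, hS⟩ := hfin.fg_top
  let T : Finset (α.HomStar X Y) := S.biUnion fun s =>
    (α.degrees s.1).image fun i => α.of X Y i (α.component s.1 i)
  have hT : ∀ h ∈ T, ∃ i, n ≤ i ∧ h ∈ α.homDegree X Y i := by
    intro h hh
    obtain ⟨s, hs, hh⟩ := Finset.mem_biUnion.mp hh
    obtain ⟨i, hi, rfl⟩ := Finset.mem_image.mp hh
    refine ⟨i, ?_, fun j hj => α.component_of_ne _ hj.symm⟩
    by_contra hcon
    exact DFinsupp.mem_support_iff.mp hi (s.2 i (by omega))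
  choose! δ hδ hmem using hT
  have hTann : ∀ a : evenSubring 𝒜, (∀ h ∈ T, a • h = 0) →
      a ∈ Module.annihilator (evenSubring 𝒜) (α.homGE X Y n) := by
    intro a ha
    have hle : (⊤ : Submodule (evenSubring 𝒜) (α.homGE X Y n)) ≤
        LinearMap.ker (LinearMap.lsmul (evenSubring 𝒜) (α.homGE X Y n) a) := by
      rw [← hS, Submodule.span_le]
      intro s hs
      rw [SetLike.mem_coe, LinearMap.mem_ker]
      apply Subtype.ext
      change a • s.1 = 0
      rw [← α.sum_of_component s.1, Finset.smul_sum]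
      exact Finset.sum_eq_zero fun i hi => ha _
        (Finset.mem_biUnion.mpr ⟨s, hs, Finset.mem_image.mpr ⟨i, hi, rfl⟩⟩)
    rw [Module.mem_annihilator]
    exact fun m => hle (Submodule.mem_top (x := m))
  have hart : ∀ h : T, IsArtinian (SetLike.GradeZero.subring 𝒜) (α.homDegree X Y (δ h)) :=
    fun h => (isFiniteLength_iff_isNoetherian_isArtinian.mp (hlen _ (hδ h h.2))).2
  -- The tuple `m` of homogeneous generators lies in a module that is Artinian over `R_0`, and a
  -- degree-zero element killing `m` annihilates `Hom^{≥ n}(X,Y)`.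
  let P := ∀ h : T, α.homDegree X Y (δ h)
  let m : P := fun h => ⟨h, hmem h h.2⟩
  rw [Ideal.isMaximal_iff]
  refine ⟨(Ideal.ne_top_iff_one p).mp hp.ne_top, fun J x hpJ hxp hxJ => ?_⟩
  let y : evenSubring 𝒜 := decompose (evenGrading 𝒜) x 0
  have hy0 : y ∈ evenGrading 𝒜 0 := SetLike.coe_mem _
  have hxy : x - y ∈ p := hirr (by
    rw [HomogeneousIdeal.mem_iff, HomogeneousIdeal.mem_irrelevant_iff, map_sub, sub_eq_zero]
    simp [GradedRing.proj_apply, y])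
  let y' : SetLike.GradeZero.subring 𝒜 := ⟨y.1, hy0⟩
  -- Stabilisation of the submodules `R_0 y^k m` gives `z y^(k+1) m = y^k m`, so `y`, which is
  -- congruent to `x` modulo `p`, is invertible modulo `p`.
  obtain ⟨k, hk⟩ := IsArtinian.monotone_stabilizes (R := SetLike.GradeZero.subring 𝒜) (M := P)
    ⟨fun k => OrderDual.toDual (Submodule.span (SetLike.GradeZero.subring 𝒜) {y' ^ k • m}),
      monotone_nat_of_le_succ fun k => by
        change Submodule.span _ {y' ^ (k + 1) • m} ≤ Submodule.span _ {y' ^ k • m}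
        rw [Submodule.span_singleton_le_iff_mem, pow_succ', mul_smul]
        exact Submodule.smul_mem _ _ (Submodule.mem_span_singleton_self _)⟩
  have hk' : y' ^ k • m ∈ Submodule.span (SetLike.GradeZero.subring 𝒜) {y' ^ (k + 1) • m} := by
    have := hk (k + 1) (Nat.le_succ k)
    have h2 : Submodule.span (SetLike.GradeZero.subring 𝒜) {y' ^ k • m} =
      Submodule.span (SetLike.GradeZero.subring 𝒜) {y' ^ (k + 1) • m} := this
    rw [← h2]
    exact Submodule.mem_span_singleton_self _
  obtain ⟨z, hz⟩ := Submodule.mem_span_singleton.mp hk'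
  let z' : evenSubring 𝒜 := ⟨z.1, mem_evenSubring_of_mem 𝒜 Even.zero z.2⟩
  have hmemp : z' * y ^ (k + 1) - y ^ k ∈ p := hann (hTann _ fun h hh => by
    have h1 := congrArg Subtype.val (congrFun hz ⟨h, hh⟩)
    rw [sub_smul, mul_smul, sub_eq_zero]
    exact h1)
  have hfac : z' * y ^ (k + 1) - y ^ k = y ^ k * (z' * y - 1) := by ring
  rw [hfac] at hmemp
  have hyp : y ∉ p := fun hy => hxp (by simpa using p.add_mem hxy hy)
  have h1 : z' * y - 1 ∈ p :=
    (hp.mem_or_mem hmemp).resolve_left fun h => hyp (hp.mem_of_pow_mem k h)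
  have hyJ : y ∈ J := by simpa using J.sub_mem hxJ (hpJ hxy)
  simpa using J.sub_mem (J.mul_mem_left z' hyJ) (hpJ h1)

end CentralAction

/-! ### Central elements and shifts -/

section CenterShift

variable {C : Type u} [Category.{v} C] [Preadditive C] [HasShift C ℤ]
  [∀ n : ℤ, (shiftFunctor C n).Additive]

/-- One more suspension contributes the sign `(-1)^n` from the definition of the center.
Faithfulness of `Σ` makes this an equivalence, which allows induction towards negative `i` as well.
-/
lemma gradedCenter.app_shift_iff {n : ℤ} (f : gradedCenter C n) (Z : C) (i : ℤ) :
    f.1.app (Z⟦i + 1⟧) = (n * (i + 1)).negOnePow •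
        ((f.1.app Z)⟦i + 1⟧' ≫ (shiftFunctorComm C n (i + 1)).hom.app Z) ↔
      f.1.app (Z⟦i⟧) = (n * i).negOnePow •
        ((f.1.app Z)⟦i⟧' ≫ (shiftFunctorComm C n i).hom.app Z) := by
  have h1 := f.1.naturality ((shiftFunctorAdd C i 1).hom.app Z)
  have h2 := f.2 (Z⟦i⟧)
  have h3 := shiftFunctorComm_hom_app_comp_shift_shiftFunctorAdd_hom_app (C := C) n i 1 Z
  have h4 := (shiftFunctorAdd C i 1).hom.naturality (f.1.app Z)
  dsimp at h1 h4
  simp only [shiftComm, Iso.app_hom] at h2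
  rw [← cancel_mono (((shiftFunctorAdd C i 1).hom.app Z)⟦n⟧'), ← h1, h2, mul_add, mul_one,
    Int.negOnePow_add]
  simp only [Linear.units_smul_comp, Linear.comp_units_smul, Category.assoc, h3]
  rw [reassoc_of% h4, mul_comm (n * i).negOnePow, mul_smul, smul_left_cancel_iff,
    ← Linear.comp_units_smul, cancel_epi, ← Functor.map_comp_assoc, ← Linear.units_smul_comp,
    cancel_mono, ← Functor.map_units_smul]
  exact (shiftFunctor C (1 : ℤ)).map_injective.eq_iff

/-- The compatibility of a central element with all shifts. -/
lemma gradedCenter.app_shift {n : ℤ} (f : gradedCenter C n) (Z : C) (i : ℤ) :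
    f.1.app (Z⟦i⟧) = (n * i).negOnePow •
        ((f.1.app Z)⟦i⟧' ≫ (shiftFunctorComm C n i).hom.app Z) := by
  induction i using Int.induction_on with
  | zero =>
    have h1 := f.1.naturality ((shiftFunctorZero C ℤ).hom.app Z)
    have h2 := (shiftFunctorZero C ℤ).hom.naturality (f.1.app Z)
    dsimp at h1 h2
    rw [shiftFunctorComm_zero_hom_app, reassoc_of% h2, mul_zero, Int.negOnePow_zero, one_smul,
      reassoc_of% h1, ← Functor.map_comp]
    simp
  | succ i ih => exact (gradedCenter.app_shift_iff f Z i).mpr ih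
  | pred i ih =>
    refine (gradedCenter.app_shift_iff f Z (-i - 1)).mp ?_
    rw [sub_add_cancel]
    exact ih

/-- An isomorphism with the signed interchange of shifts as its morphism. -/
def signedShiftComm (Z : C) (n i : ℤ) : Z⟦n⟧⟦i⟧ ≅ Z⟦i⟧⟦n⟧ where
  hom := (n * i).negOnePow • (shiftFunctorComm C n i).hom.app Z
  inv := (n * i).negOnePow • (shiftFunctorComm C n i).inv.app Z
  hom_inv_id := by
    simp [Linear.units_smul_comp, Linear.comp_units_smul, smul_smul, Int.units_mul_self]
  inv_hom_id := by
    simp [Linear.units_smul_comp, Linear.comp_units_smul, smul_smul, Int.units_mul_self]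

end CenterShift

namespace CentralAction

section Preadditive

variable {C : Type u} [Category.{v} C] [Preadditive C] [HasShift C ℤ]
  [∀ n : ℤ, (shiftFunctor C n).Additive]
  {R : Type w} [Ring R] {𝒜 : ℕ → AddSubgroup R} [GradedRing 𝒜] (α : CentralAction C 𝒜)

lemma phi_naturality {Y Z : C} (g : Y ⟶ Z) {d : ℕ} (r : 𝒜 d) :
    g ≫ α.phi Z r = α.phi Y r ≫ g⟦(d : ℤ)⟧' :=
  (α.toCenter d r).1.naturality g

lemma phi_naturality_assoc {Y Z W : C} (g : Y ⟶ Z) {d : ℕ} (r : 𝒜 d) (h : Z⟦(d : ℤ)⟧ ⟶ W) :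
    g ≫ α.phi Z r ≫ h = α.phi Y r ≫ g⟦(d : ℤ)⟧' ≫ h := by
  rw [← Category.assoc, phi_naturality, Category.assoc]

lemma phi_shift (Z : C) (i : ℤ) {d : ℕ} (r : 𝒜 d) :
    α.phi (Z⟦i⟧) r = (α.phi Z r)⟦i⟧' ≫ (signedShiftComm Z (d : ℤ) i).hom := by
  simp only [signedShiftComm, Linear.comp_units_smul]
  exact gradedCenter.app_shift (α.toCenter d r) Z i

lemma shift_phi (Z : C) (i : ℤ) {d : ℕ} (r : 𝒜 d) :
    (α.phi Z r)⟦i⟧' = α.phi (Z⟦i⟧) r ≫ (signedShiftComm Z (d : ℤ) i).inv := by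
  rw [phi_shift, Category.assoc, Iso.hom_inv_id, Category.comp_id]

lemma phi_shift_self (Z : C) {d : ℕ} (r : 𝒜 d) :
    α.phi (Z⟦(d : ℤ)⟧) r = ((d : ℤ) * d).negOnePow • (α.phi Z r)⟦(d : ℤ)⟧' := by
  rw [phi_shift]
  simp [signedShiftComm, Linear.comp_units_smul]

/-- The product of two homogeneous elements. -/
def hmul {m n : ℕ} (r : 𝒜 m) (s : 𝒜 n) : 𝒜 (m + n) :=
  ⟨r.1 * s.1, SetLike.GradedMul.mul_mem r.2 s.2⟩

/-- `φ_Z(rs)` is, up to a canonical isomorphism, `φ_Z(s)` followed by `φ_{Σ^{|s|}Z}(r)`. -/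
lemma exists_phi_hmul (Z : C) (m n : ℕ) : ∃ τ : Z⟦(n : ℤ)⟧⟦(m : ℤ)⟧ ≅ Z⟦((m + n : ℕ) : ℤ)⟧,
    ∀ (r : 𝒜 m) (s : 𝒜 n), α.phi Z (hmul r s) =
      α.phi Z s ≫ α.phi (Z⟦(n : ℤ)⟧) r ≫ τ.hom := by
  -- Signs and identifications of shifts are absorbed into `τ`, which does not depend on `r` and
  -- `s`.
  refine ⟨(signedShiftComm Z (m : ℤ) (n : ℤ)).symm ≪≫
    ((shiftFunctorAdd' C (m : ℤ) (n : ℤ) _ (Nat.cast_add m n).symm).app Z).symm, fun r s => ?_⟩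
  rw [phi_shift]
  simp only [Iso.trans_hom, Iso.symm_hom, Category.assoc, Iso.hom_inv_id_assoc]
  exact congrArg (fun z : gradedCenter C ((m + n : ℕ) : ℤ) => z.1.app Z) (α.map_mul m n r s)

/-- The module structure in terms of `φ_{ΣⁱY}`. -/
lemma exists_smul_of_eq (X Y : C) (d : ℕ) (i : ℤ) : ∃ τ : Y⟦i⟧⟦(d : ℤ)⟧ ≅ Y⟦(d : ℤ) + i⟧,
    ∀ (r : 𝒜 d) (g : X ⟶ Y⟦i⟧), (r : R) • α.of X Y i g =
      α.of X Y ((d : ℤ) + i) (g ≫ α.phi (Y⟦i⟧) r ≫ τ.hom) := by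
  refine ⟨(signedShiftComm Y (d : ℤ) i).symm ≪≫
    ((shiftFunctorAdd' C (d : ℤ) i _ rfl).app Y).symm, fun r g => ?_⟩
  rw [smul_of, phi_shift]
  simp only [Iso.trans_hom, Iso.symm_hom, Category.assoc, Iso.hom_inv_id_assoc]
  rfl

lemma smul_of_eq_zero_iff {X Y : C} {d : ℕ} {i : ℤ} (r : 𝒜 d) (g : X ⟶ Y⟦i⟧) :
    (r : R) • α.of X Y i g = 0 ↔ g ≫ α.phi (Y⟦i⟧) r = 0 := by
  obtain ⟨τ, hτ⟩ := α.exists_smul_of_eq X Y d i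
  rw [hτ]
  constructor
  · intro h
    have h' := congrArg (fun f => α.component f ((d : ℤ) + i)) h
    simp only [component_of_self, component_zero] at h'
    rw [← cancel_mono τ.hom, Category.assoc, h', zero_comp]
  · intro h
    rw [reassoc_of% h, zero_comp, map_zero]

/-- Every morphism of the form `w ≫ φ_W(r) ≫ ι` is a multiple of `r`. -/
lemma exists_eq_smul_of {X Y W : C} {d : ℕ} (r : 𝒜 d) (w : X ⟶ W) {N : ℤ}
    (ι : W⟦(d : ℤ)⟧ ⟶ Y⟦N⟧) {M : ℤ} (hM : (d : ℤ) + M = N) :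
    ∃ w' : X ⟶ Y⟦M⟧, α.of X Y N (w ≫ α.phi W r ≫ ι) = (r : R) • α.of X Y M w' := by
  subst hM
  obtain ⟨τ, hτ⟩ := α.exists_smul_of_eq X Y d M
  -- Fullness of the shift writes `ι`, up to `τ`, as a shifted morphism, and naturality moves it
  -- across `φ(r)`.
  obtain ⟨ρ, hρ⟩ := (shiftFunctor C (d : ℤ)).map_surjective (ι ≫ τ.inv)
  refine ⟨w ≫ ρ, ?_⟩
  rw [hτ]
  congr 1
  rw [Category.assoc, α.phi_naturality_assoc ρ, hρ]
  simp

/-- The homogeneous element `a` annihilates all morphisms from `Y` to `Z`. -/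
def Kills {e : ℕ} (a : 𝒜 e) (Y Z : C) : Prop := ∀ g : Y ⟶ Z, g ≫ α.phi Z a = 0

variable {α}

lemma Kills.of_iso {e : ℕ} {a : 𝒜 e} {Y Z Z' : C} (h : α.Kills a Y Z) (i : Z ≅ Z') :
    α.Kills a Y Z' := by
  intro g
  have := h (g ≫ i.inv)
  rw [Category.assoc, α.phi_naturality, ← Category.assoc] at this
  rwa [← cancel_mono (i.inv⟦(e : ℤ)⟧'), zero_comp]

lemma Kills.shift {e : ℕ} {a : 𝒜 e} {Y Z : C} (h : α.Kills a Y Z) (i : ℤ) :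
    α.Kills a (Y⟦i⟧) (Z⟦i⟧) := by
  intro g
  obtain ⟨g, rfl⟩ := (shiftFunctor C i).map_surjective g
  rw [phi_shift, ← Functor.map_comp_assoc, h g, Functor.map_zero, zero_comp]

lemma kills_hmul {m n : ℕ} {r : 𝒜 m} {s : 𝒜 n} {Y Z : C}
    (h : ∀ g : Y ⟶ Z, g ≫ α.phi Z s ≫ α.phi (Z⟦(n : ℤ)⟧) r = 0) : α.Kills (hmul r s) Y Z := by
  intro g
  obtain ⟨τ, hτ⟩ := α.exists_phi_hmul Z m n
  have := h g
  rw [← Category.assoc] at this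
  rw [hτ, reassoc_of% this, zero_comp]

end Preadditive

/-! ### Annihilation along distinguished triangles -/

section Triangulated

variable {C : Type u} [Category.{v} C] [Preadditive C] [HasZeroObject C] [HasShift C ℤ]
  [∀ n : ℤ, (shiftFunctor C n).Additive] [Pretriangulated C]
  {R : Type w} [Ring R] {𝒜 : ℕ → AddSubgroup R} [GradedRing 𝒜] {α : CentralAction C 𝒜}

/-- The shifted triangle has its morphisms multiplied by `(-1)^n`; the sign is absorbed into the
lift. -/
lemma exists_lift_shift_mor₂ {T : Triangle C} (hT : T ∈ distTriang C) (n : ℤ) {Y : C}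
    (g : Y ⟶ T.obj₃⟦n⟧) (hg : g ≫ T.mor₃⟦n⟧' = 0) :
    ∃ u : Y ⟶ T.obj₂⟦n⟧, g = u ≫ T.mor₂⟦n⟧' := by
  obtain ⟨(u : Y ⟶ T.obj₂⟦n⟧), (hu : g = u ≫ (n.negOnePow • T.mor₂⟦n⟧'))⟩ :=
    Triangle.coyoneda_exact₃ _ (Triangle.shift_distinguished _ hT n) g (by
    change g ≫ (n.negOnePow • (T.mor₃⟦n⟧' ≫ (shiftFunctorComm C 1 n).hom.app T.obj₁)) = 0
    rw [Linear.comp_units_smul, reassoc_of% hg, zero_comp, smul_zero])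
  refine ⟨n.negOnePow • u, ?_⟩
  rw [hu, Linear.comp_units_smul, Linear.units_smul_comp]

lemma exists_lift_shift_mor₁ {T : Triangle C} (hT : T ∈ distTriang C) (n : ℤ) {Y : C}
    (g : Y ⟶ T.obj₂⟦n⟧) (hg : g ≫ T.mor₂⟦n⟧' = 0) :
    ∃ u : Y ⟶ T.obj₁⟦n⟧, g = u ≫ T.mor₁⟦n⟧' := by
  obtain ⟨(u : Y ⟶ T.obj₁⟦n⟧), (hu : g = u ≫ (n.negOnePow • T.mor₁⟦n⟧'))⟩ :=
    Triangle.coyoneda_exact₂ _ (Triangle.shift_distinguished _ hT n) g (by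
    change g ≫ (n.negOnePow • T.mor₂⟦n⟧') = 0
    rw [Linear.comp_units_smul, hg, smul_zero])
  refine ⟨n.negOnePow • u, ?_⟩
  rw [hu, Linear.comp_units_smul, Linear.units_smul_comp]

/-- Multiplication by `b` kills the obstruction in `T.obj₁⟦1⟧` to lifting to `T.obj₂⟦n⟧`, and `a`
then kills the lift. -/
lemma Kills.cone_target {T : Triangle C} (hT : T ∈ distTriang C) {m n : ℕ} {a : 𝒜 m} {b : 𝒜 n}
    {Y : C} (h₁ : α.Kills b Y (T.obj₁⟦(1 : ℤ)⟧)) (h₂ : α.Kills a Y (T.obj₂⟦(n : ℤ)⟧)) :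
    α.Kills (hmul a b) Y T.obj₃ := by
  refine kills_hmul fun g => ?_
  obtain ⟨u, hu⟩ := exists_lift_shift_mor₂ hT (n : ℤ) (g ≫ α.phi T.obj₃ b) (by
    rw [Category.assoc, ← α.phi_naturality, ← Category.assoc]
    exact h₁ _)
  rw [← Category.assoc, hu, Category.assoc, α.phi_naturality, reassoc_of% (h₂ u), zero_comp]

/-- Dually, after multiplication by `b` the morphism factors through `T.mor₃`, and `a` kills the
factor. -/
lemma Kills.cone_source {T : Triangle C} (hT : T ∈ distTriang C) {m n : ℕ} {a : 𝒜 m} {b : 𝒜 n}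
    {Z : C} (h₂ : α.Kills b T.obj₂ Z) (h₁ : α.Kills a (T.obj₁⟦(1 : ℤ)⟧) (Z⟦(n : ℤ)⟧)) :
    α.Kills (hmul a b) T.obj₃ Z := by
  refine kills_hmul fun g => ?_
  obtain ⟨u, hu⟩ := Triangle.yoneda_exact₃ _ hT (g ≫ α.phi Z b) (by
    rw [← Category.assoc]
    exact h₂ _)
  rw [← Category.assoc, hu, Category.assoc, h₁ u, comp_zero]

/-- The shift by `i` of a shift by `j`. -/
def shiftShiftIso (Z : C) {i j k : ℤ} (h : i + j = k) : Z⟦i⟧⟦j⟧ ≅ Z⟦k⟧ :=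
  ((shiftFunctorAdd' C i j k h).app Z).symm

/-! ### Elements acting trivially on a Koszul object -/

section Koszul

variable {X K : C} {d : ℕ} {r : 𝒜 d}

/-- Each passage through the triangle, in the target and then in the source, squares the element.
The source passage uses targets `K⟦i - d⟧` and `K⟦i + 2e - 1⟧`, whence the bound `n + d + 1`. -/
lemma IsKoszulObject.kills_pow (hK : α.IsKoszulObject X r K) {e : ℕ} {a : 𝒜 e} {n : ℤ}
    (h : ∀ i, n ≤ i → α.Kills a X (X⟦i⟧)) {i : ℤ} (hi : n + d + 1 ≤ i) :
    α.Kills (hmul (hmul a a) (hmul a a)) K (K⟦i⟧) := by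
  obtain ⟨g, k, hT⟩ := hK
  have hXK : ∀ i, n ≤ i → α.Kills (hmul a a) X (K⟦i⟧) := by
    intro i hi
    have hTi := Triangle.shift_distinguished _ hT i
    refine Kills.cone_target hTi ?_ ?_
    · exact (h (i + 1) (by omega)).of_iso (shiftShiftIso X rfl).symm
    · exact (h (d + i + e) (by omega)).of_iso
        ((shiftFunctor C (e : ℤ)).mapIso (shiftShiftIso X rfl) ≪≫ shiftShiftIso X rfl).symm
  refine Kills.cone_source hT ?_ ?_
  · exact ((hXK (i - d) (by omega)).shift d).of_iso (shiftShiftIso K (by omega))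
  · exact ((hXK (i + ((e + e : ℕ) : ℤ) - 1) (by omega)).shift 1).of_iso
      (shiftShiftIso K (by omega) ≪≫ (shiftShiftIso K rfl).symm)

/-- `φ_K(r)` dies after projection to the shift of `ΣX`, so it factors through a shift of `g`; and
`g` followed by `φ_K(r)` is zero, since `φ_X(r) ≫ g = 0`. -/
lemma IsKoszulObject.phi_comp_phi (hK : α.IsKoszulObject X r K) :
    α.phi K r ≫ α.phi (K⟦(d : ℤ)⟧) r = 0 := by
  obtain ⟨g, k, hT⟩ := hK
  have h31 : k ≫ (α.phi X r)⟦(1 : ℤ)⟧' = 0 := comp_distTriang_mor_zero₃₁ _ hT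
  have h12 : α.phi X r ≫ g = 0 := comp_distTriang_mor_zero₁₂ _ hT
  obtain ⟨(u : K ⟶ X⟦(d : ℤ)⟧⟦(d : ℤ)⟧), (hu : α.phi K r = u ≫ g⟦(d : ℤ)⟧')⟩ :=
    exists_lift_shift_mor₂ hT (d : ℤ) (α.phi K r) (by
    change α.phi K r ≫ k⟦(d : ℤ)⟧' = 0
    rw [← α.phi_naturality, phi_shift, reassoc_of% h31, zero_comp])
  have hg : g ≫ α.phi K r = 0 := by
    rw [α.phi_naturality, phi_shift_self, Linear.units_smul_comp, ← Functor.map_comp, h12,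
      Functor.map_zero, smul_zero]
  conv_lhs => rw [hu, Category.assoc, phi_shift, ← Functor.map_comp_assoc, hg]
  simp

lemma IsKoszulObject.kills_sq (hK : α.IsKoszulObject X r K) (Z : C) : α.Kills (hmul r r) K Z := by
  refine kills_hmul fun g => ?_
  rw [α.phi_naturality_assoc g, α.phi_naturality (g⟦(d : ℤ)⟧'), ← Category.assoc,
    hK.phi_comp_phi, zero_comp]

/-- If `b` vanishes on the Koszul object, then `b` maps `Hom^*(X,X)` into the multiples of `r`. -/
lemma IsKoszulObject.exists_smul_eq_smul (hK : α.IsKoszulObject X r K) {e : ℕ} {b : 𝒜 e}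
    (hb : α.phi K b = 0) {i : ℤ} (f : X ⟶ X⟦i⟧) :
    ∃ w : X ⟶ X⟦(e : ℤ) + i - d⟧,
      (b : R) • α.of X X i f = (r : R) • α.of X X ((e : ℤ) + i - d) w := by
  obtain ⟨g, k, hT⟩ := hK
  -- By naturality, `φ(b)` on `X⟦d⟧` followed by the shift of `g` is `g` followed by `φ_K(b) = 0`,
  -- so it factors through the shift of `φ_X(r)`. Shifting by `i - d` transports this to `X⟦i⟧`.
  obtain ⟨(u : X⟦(d : ℤ)⟧ ⟶ X⟦(e : ℤ)⟧),
      (hu : α.phi (X⟦(d : ℤ)⟧) b = u ≫ (α.phi X r)⟦(e : ℤ)⟧')⟩ :=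
    exists_lift_shift_mor₁ hT (e : ℤ) (α.phi (X⟦(d : ℤ)⟧) b) (by
    change α.phi (X⟦(d : ℤ)⟧) b ≫ g⟦(e : ℤ)⟧' = 0
    rw [← α.phi_naturality, hb, comp_zero])
  obtain ⟨τ, hτ⟩ := α.exists_smul_of_eq X X e i
  let κ : X⟦(d : ℤ)⟧⟦i - d⟧ ≅ X⟦i⟧ := shiftShiftIso X (by omega)
  have hb' : α.phi (X⟦i⟧) b = κ.inv ≫ u⟦i - d⟧' ≫ α.phi (X⟦(e : ℤ)⟧⟦i - d⟧) r ≫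
      (signedShiftComm (X⟦(e : ℤ)⟧) (d : ℤ) (i - d)).inv ≫
      ((signedShiftComm X (d : ℤ) (e : ℤ)).inv)⟦i - d⟧' ≫
      (signedShiftComm (X⟦(d : ℤ)⟧) (e : ℤ) (i - d)).hom ≫ κ.hom⟦(e : ℤ)⟧' := by
    have h1 : α.phi (X⟦i⟧) b = κ.inv ≫ α.phi _ b ≫ κ.hom⟦(e : ℤ)⟧' := by
      rw [← α.phi_naturality, Iso.inv_hom_id_assoc]
    rw [h1, phi_shift, hu, shift_phi, Functor.map_comp, Functor.map_comp, shift_phi]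
    simp only [Category.assoc]
  rw [hτ, hb']
  obtain ⟨w, hw⟩ := α.exists_eq_smul_of (Y := X) r (f ≫ κ.inv ≫ u⟦i - d⟧')
    ((signedShiftComm (X⟦(e : ℤ)⟧) (d : ℤ) (i - d)).inv ≫
      ((signedShiftComm X (d : ℤ) (e : ℤ)).inv)⟦i - d⟧' ≫
      (signedShiftComm (X⟦(d : ℤ)⟧) (e : ℤ) (i - d)).hom ≫ κ.hom⟦(e : ℤ)⟧' ≫ τ.hom)
    (M := (e : ℤ) + i - d) (by omega)
  exact ⟨w, by simpa only [Category.assoc] using hw⟩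

end Koszul

end Triangulated

end CentralAction

/-! ### Complexity of Koszul objects -/

lemma unbotD_zero_mono {a b : WithBot ℕ∞} (h : a ≤ b) : a.unbotD 0 ≤ b.unbotD 0 := by
  induction a using WithBot.recBotCoe with
  | bot => simp
  | coe a =>
    induction b using WithBot.recBotCoe with
    | bot => simp at h
    | coe b => simpa using h

lemma le_natCast_of_add_one_le {a : WithBot ℕ∞} {k : ℕ}
    (h : a + 1 ≤ ((k + 1 : ℕ) : WithBot ℕ∞)) : a ≤ k := by
  induction a using WithBot.recBotCoe with
  | bot => exact bot_le
  | coe a =>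
    have h' : a + 1 ≤ ((k + 1 : ℕ) : ℕ∞) := WithBot.coe_le_coe.mp h
    rw [Nat.cast_add, Nat.cast_one] at h'
    exact WithBot.coe_le_coe.mpr ((ENat.add_le_add_iff_right ENat.one_ne_top).mp h')

lemma natCast_le_of_le_add_one {a : WithBot ℕ∞} {k : ℕ}
    (h : ((k + 1 : ℕ) : WithBot ℕ∞) ≤ a + 1) : (k : WithBot ℕ∞) ≤ a := by
  induction a using WithBot.recBotCoe with
  | bot => exact absurd h (WithBot.bot_lt_coe _).not_ge
  | coe a =>
    have h' : ((k + 1 : ℕ) : ℕ∞) ≤ a + 1 := WithBot.coe_le_coe.mp h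
    rw [Nat.cast_add, Nat.cast_one] at h'
    exact WithBot.coe_le_coe.mpr ((ENat.add_le_add_iff_right ENat.one_ne_top).mp h')

/-- A commutative ring acting faithfully on a Noetherian module is Noetherian. -/
lemma isNoetherianRing_quotient_annihilator (A M : Type*) [CommRing A] [AddCommGroup M] [Module A M]
    [IsNoetherian A M] : IsNoetherianRing (A ⧸ Module.annihilator A M) := by
  obtain ⟨S, hS⟩ := IsNoetherian.noetherian (⊤ : Submodule A M)
  -- Evaluation on a finite generating set embeds the quotient by the annihilator into a finite
  -- power of `M`.
  let g : A →ₗ[A] (S → M) := LinearMap.pi fun s => LinearMap.toSpanSingleton A M s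
  have hg : Module.annihilator A M = LinearMap.ker g := by
    ext a
    rw [← Submodule.annihilator_top, ← hS, Submodule.mem_annihilator_span, LinearMap.mem_ker]
    simp [g, funext_iff]
  have hN : IsNoetherian A (A ⧸ Module.annihilator A M) := by
    rw [hg]
    exact isNoetherian_of_linearEquiv g.quotKerEquivRange.symm
  exact isNoetherian_of_tower A hN

namespace CentralAction

section Dimension

variable {C : Type u} [Category.{v} C] [Preadditive C] [HasShift C ℤ]
  [∀ n : ℤ, (shiftFunctor C n).Additive]
  {R : Type w} [Ring R] {𝒜 : ℕ → AddSubgroup R} [GradedRing 𝒜] [IsGradedCommutative 𝒜]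
  (α : CentralAction C 𝒜)

lemma supportDim_homGE_anti (X Y : C) {m n : ℤ} (h : m ≤ n) :
    Module.supportDim (evenSubring 𝒜) (α.homGE X Y n) ≤
      Module.supportDim (evenSubring 𝒜) (α.homGE X Y m) :=
  Module.supportDim_le_of_injective
    ((Submodule.inclusion (α.homGE_anti X Y h)).restrictScalars (evenSubring 𝒜))
    (Submodule.inclusion_injective (α.homGE_anti X Y h))

/-- The complexity is attained by all sufficiently large truncations. -/
lemma exists_cxPair_eq (X Y : C) : ∃ m : ℤ, ∀ n, m ≤ n →
    α.cxPair X Y = (Module.supportDim (evenSubring 𝒜) (α.homGE X Y n)).unbotD 0 := by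
  obtain ⟨m, hm⟩ : α.cxPair X Y ∈ Set.range fun n : ℤ =>
    (Module.supportDim (evenSubring 𝒜) (α.homGE X Y n)).unbotD 0 :=
    csInf_mem (Set.range_nonempty _)
  refine ⟨m, fun n hn => le_antisymm (iInf_le _ n) ?_⟩
  rw [← hm]
  exact unbotD_zero_mono (α.supportDim_homGE_anti X Y hn)

end Dimension

section Koszul

variable {C : Type u} [Category.{v} C] [Preadditive C] [HasZeroObject C] [HasShift C ℤ]
  [∀ n : ℤ, (shiftFunctor C n).Additive] [Pretriangulated C]
  {R : Type w} [Ring R] {𝒜 : ℕ → AddSubgroup R} [GradedRing 𝒜] [IsGradedCommutative 𝒜]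
  {α : CentralAction C 𝒜} {X K : C} {d : ℕ} {r : evenSubring 𝒜} {hr : r ∈ evenGrading 𝒜 d}

/-- The support of `Hom^{≥ m}(X//r, X//r)` lies over the annihilator of `Hom^{≥ n}(X,X)` and `r`. -/
lemma IsKoszulObject.support_subset (hK : α.IsKoszulObject X (⟨r, hr⟩ : 𝒜 d) K) {n m : ℤ}
    (hm : n + d + 1 ≤ m) :
    Module.support (evenSubring 𝒜) (α.homGE K K m) ⊆ PrimeSpectrum.zeroLocus
      ((Module.annihilator (evenSubring 𝒜) (α.homGE X X n) ⊔ Ideal.span {r} :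
        Ideal (evenSubring 𝒜)) : Set (evenSubring 𝒜)) := by
  classical
  intro p hp
  have hann := Module.annihilator_le_of_mem_support hp
  change _ ⊔ _ ≤ p.asIdeal
  refine sup_le (fun a ha => ?_) ?_
  · rw [← DirectSum.sum_support_decompose (evenGrading 𝒜) a]
    refine sum_mem fun j _ => ?_
    have haj := α.isHomogeneous_annihilator X X n j ha
    have hbj := (decompose (evenGrading 𝒜) a j).2
    generalize ((decompose (evenGrading 𝒜) a j : evenGrading 𝒜 j) : evenSubring 𝒜) = b at haj hbj
    rw [mem_annihilator_homGE] at haj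
    have hkill : ∀ i, n ≤ i → α.Kills (⟨b, hbj⟩ : 𝒜 j) X (X⟦i⟧) := fun i hi g =>
      (α.smul_of_eq_zero_iff (⟨b, hbj⟩ : 𝒜 j) g).mp (haj i hi g)
    have hmem : (b * b) * (b * b) ∈ Module.annihilator (evenSubring 𝒜) (α.homGE K K m) := by
      rw [mem_annihilator_homGE]
      intro i hi g
      exact (α.smul_of_eq_zero_iff _ g).mpr (hK.kills_pow hkill (hm.trans hi) g)
    rcases p.isPrime.mem_or_mem (hann hmem) with h | h <;>
    exact (p.isPrime.mem_or_mem h).elim id id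
  · rw [Ideal.span_singleton_le_iff_mem]
    have hmem : r * r ∈ Module.annihilator (evenSubring 𝒜) (α.homGE K K m) := by
      rw [mem_annihilator_homGE]
      intro i hi g
      exact (α.smul_of_eq_zero_iff _ g).mpr (hK.kills_sq _ g)
    exact (p.isPrime.mem_or_mem (hann hmem)).elim id id

/-- An even homogeneous element of large degree vanishing on `X//r` lies in all primes over the
annihilator of `Hom^{≥ n}(X,X)` and `r`. -/
lemma IsKoszulObject.mem_of_phi_eq_zero (hK : α.IsKoszulObject X (⟨r, hr⟩ : 𝒜 d) K) {n : ℤ}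
    (hfin : Module.Finite (evenSubring 𝒜) (α.homGE X X n)) {p : PrimeSpectrum (evenSubring 𝒜)}
    (hp : Module.annihilator (evenSubring 𝒜) (α.homGE X X n) ≤ p.asIdeal) (hrp : r ∈ p.asIdeal)
    {e : ℕ} (he : d ≤ e) {b : evenSubring 𝒜} (hb : b ∈ evenGrading 𝒜 e)
    (hb0 : α.phi K (⟨b, hb⟩ : 𝒜 e) = 0) : b ∈ p.asIdeal := by
  -- For the finite module `M`, the support of `M/rM` is `V(ann M + (r))`, so it suffices that `b`
  -- maps `M` into `rM`.
  have hsupp : p ∈ Module.support (evenSubring 𝒜) (QuotSMulTop r (α.homGE X X n)) := by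
    rw [Module.support_quotSMulTop, Module.support_eq_zeroLocus]
    exact ⟨hp, by simpa using hrp⟩
  refine Module.annihilator_le_of_mem_support hsupp ?_
  rw [Module.mem_annihilator]
  intro z
  obtain ⟨⟨f, hf⟩, rfl⟩ := Submodule.Quotient.mk_surjective _ z
  rw [← Submodule.Quotient.mk_smul, Submodule.Quotient.mk_eq_zero]
  have hsum : b • (⟨f, hf⟩ : α.homGE X X n) = ∑ i ∈ α.degrees f,
      b • (⟨α.of X X i (α.component f i), α.of_component_mem_homGE hf i⟩ : α.homGE X X n) := by
    rw [← Finset.smul_sum]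
    congr 1
    apply Subtype.ext
    rw [AddSubmonoidClass.coe_finsetSum]
    exact (α.sum_of_component f).symm
  rw [hsum]
  refine sum_mem fun i _ => ?_
  by_cases hi : n ≤ i
  swap
  · have : b •
        (⟨α.of X X i (α.component f i), α.of_component_mem_homGE hf i⟩ : α.homGE X X n) = 0 := by
      apply Subtype.ext
      change b • α.of X X i (α.component f i) = 0
      rw [hf i (by omega), map_zero, smul_zero]
    rw [this]
    exact zero_mem _
  -- The cofactor `w` has degree `e + i - d`, which is at least `n` because `d ≤ e`.
  obtain ⟨w, hw⟩ := hK.exists_smul_eq_smul hb0 (α.component f i)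
  have : b • (⟨α.of X X i (α.component f i), α.of_component_mem_homGE hf i⟩ : α.homGE X X n) =
      r • (⟨α.of X X _ w, α.of_mem_homGE (by omega) w⟩ : α.homGE X X n) := Subtype.ext hw
  rw [this]
  exact Submodule.smul_mem_pointwise_smul _ _ _ Submodule.mem_top

/-- Primes over the annihilator of `Hom^{≥ n}(X,X)` and `r` that do not contain the irrelevant ideal
belong to the support of every `Hom^{≥ m}(X//r, X//r)`. -/
lemma IsKoszulObject.mem_support (hK : α.IsKoszulObject X (⟨r, hr⟩ : 𝒜 d) K) {n : ℤ}
    (hfin : Module.Finite (evenSubring 𝒜) (α.homGE X X n)) {p : PrimeSpectrum (evenSubring 𝒜)}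
    (hp : Module.annihilator (evenSubring 𝒜) (α.homGE X X n) ⊔ Ideal.span {r} ≤ p.asIdeal)
    (hirr : ¬ (HomogeneousIdeal.irrelevant (evenGrading 𝒜)).toIdeal ≤ p.asIdeal) (m : ℤ) :
    p ∈ Module.support (evenSubring 𝒜) (α.homGE K K m) := by
  classical
  obtain ⟨c, hc, t, ht, htp⟩ : ∃ c : ℕ, 0 < c ∧ ∃ t ∈ evenGrading 𝒜 c, t ∉ p.asIdeal := by
    by_contra! hcon
    exact hirr ((HomogeneousIdeal.toIdeal_irrelevant_le _).mpr fun i hi x hx => hcon i hi x hx)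
  -- The bound by `m` puts `φ_K(t ^ k)` into the truncation; the bound by `d` makes `b * t ^ k` of
  -- large enough degree for `mem_of_phi_eq_zero`. If `b` kills `φ_K(t ^ k)`, then `b * t ^ k`
  -- vanishes on `K`, so it lies in `p`, and hence so does `b`.
  obtain ⟨k, hk1, hk2⟩ : ∃ k : ℕ, m ≤ (k : ℤ) ∧ d ≤ k :=
    ⟨max m.toNat d, by push_cast; omega, le_max_right _ _⟩
  have hsk : t ^ k ∈ evenGrading 𝒜 (k * c) := by simpa using SetLike.pow_mem_graded k ht
  have hkc : k ≤ k * c := Nat.le_mul_of_pos_right k hc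
  have hsp : t ^ k ∉ p.asIdeal := fun h => htp (p.isPrime.mem_of_pow_mem k h)
  generalize t ^ k = s at hsk hsp
  generalize k * c = l at hsk hkc
  rw [Module.mem_support_iff_exists_annihilator]
  refine ⟨⟨α.of K K (l : ℤ) (α.phi K (⟨s, hsk⟩ : 𝒜 l)), α.of_mem_homGE (by omega) _⟩, ?_⟩
  intro a ha
  rw [Submodule.mem_annihilator_span_singleton] at ha
  have ha' : a • α.of K K (l : ℤ) (α.phi K (⟨s, hsk⟩ : 𝒜 l)) = 0 := congrArg Subtype.val ha
  rw [← DirectSum.sum_support_decompose (evenGrading 𝒜) a]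
  refine sum_mem fun j _ => ?_
  have haj := α.decompose_smul_of_eq_zero ha' j
  have hbj := (decompose (evenGrading 𝒜) a j).2
  generalize ((decompose (evenGrading 𝒜) a j : evenGrading 𝒜 j) : evenSubring 𝒜) = b at haj hbj
  have h0 := (α.smul_of_eq_zero_iff (⟨b, hbj⟩ : 𝒜 j) _).mp haj
  obtain ⟨τ, hτ⟩ := α.exists_phi_hmul K j l
  have hprod : α.phi K (hmul (⟨b, hbj⟩ : 𝒜 j) (⟨s, hsk⟩ : 𝒜 l)) = 0 := by
    rw [hτ, reassoc_of% h0, zero_comp]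
  have hbs : b * s ∈ p.asIdeal := hK.mem_of_phi_eq_zero hfin (le_sup_left.trans hp)
    (hp (Ideal.mem_sup_right (Ideal.mem_span_singleton_self r))) (e := j + l) (by omega)
    (SetLike.mul_mem_graded hbj hsk) hprod
  exact (p.isPrime.mem_or_mem hbs).resolve_right hsp

end Koszul

end CentralAction

/-- If all non-maximal points of a subset of the prime spectrum and their specializations lie in a
second subset, the dimension of the first, if positive, is at most that of the second. -/
lemma krullDim_le_of_forall_isMaximal_or_mem {A : Type*} [CommRing A] {S T : Set (PrimeSpectrum A)}
    (hT : ∀ p q, p ≤ q → p ∈ T → q ∈ T) (h : ∀ p ∈ S, p.asIdeal.IsMaximal ∨ p ∈ T)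
    (hS : 1 ≤ Order.krullDim S) : Order.krullDim S ≤ Order.krullDim T := by
  have key : ∀ l : LTSeries S, 1 ≤ l.length → (l.length : WithBot ℕ∞) ≤ Order.krullDim T := by
    intro l hl
    -- The head of a chain of positive length is not maximal, so it lies in `T`; closure under
    -- specialization puts the whole chain in `T`.
    have hhead : (l.head : PrimeSpectrum A) ∈ T := by
      refine (h _ l.head.2).resolve_left fun hmax => ?_
      have hlt : l.head < l.last := l.strictMono (by rw [Fin.lt_def]; simp; omega)
      have hlt' : l.head.1.asIdeal < l.last.1.asIdeal := hlt
      exact l.last.1.isPrime.ne_top (hmax.1.2 _ hlt')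
    let l' : LTSeries T :=
      { length := l.length
        toFun := fun i => ⟨(l i).1, hT _ _ (l.head_le i) hhead⟩
        step := fun i => l.step i }
    exact Order.LTSeries.length_le_krullDim l'
  -- A chain of positive length is needed to bound those of length 0, whose maximal point may lie
  -- outside `T`.
  obtain ⟨l, hl⟩ : ∃ l : LTSeries S, 1 ≤ l.length := by
    by_contra! hcon
    have : Order.krullDim S ≤ 0 := iSup_le fun l => by
      have := hcon l
      have h0 : l.length = 0 := by omega
      rw [h0]; rfl
    exact absurd (hS.trans this) (by decide)
  refine iSup_le fun l' => ?_
  by_cases hl' : 1 ≤ l'.length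
  · exact key l' hl'
  · refine le_trans ?_ (key l hl)
    have : l'.length ≤ l.length := by omega
    exact_mod_cast this

end

/-! ### The complexity of `X//r` -/

theorem mainTheorem6 {C : Type u} [Category.{v} C] [Preadditive C] [HasZeroObject C]
    [HasShift C ℤ] [∀ n : ℤ, (shiftFunctor C n).Additive] [Pretriangulated C] [IsTriangulated C]
    {R : Type w} [Ring R] (𝒜 : ℕ → AddSubgroup R) [GradedRing 𝒜] [IsGradedCommutative 𝒜]
    (α : CentralAction C 𝒜) (X : C)
    (hX : α.EventuallyNoetherianFL X X) (hcx : α.cx X ≠ 0) :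
    α.cx X ≠ ⊤ ∧
      ∃ (d : ℕ) (r : 𝒜 d), 0 < d ∧
        (∃ K : C, α.IsKoszulObject X r K) ∧
        ∀ K : C, α.IsKoszulObject X r K → α.cx K = α.cx X - 1 := by
  obtain ⟨⟨n₁, hN⟩, n₂, hL⟩ := hX
  obtain ⟨n₃, hn₃⟩ := α.exists_cxPair_eq X X
  -- One truncation serves for Noetherianity, for finite length and for computing the complexity.
  obtain ⟨n, h₁, h₂, h₃⟩ : ∃ n, n₁ ≤ n ∧ n₂ ≤ n ∧ n₃ ≤ n :=
    ⟨max n₁ (max n₂ n₃), by omega, by omega, by omega⟩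
  have hnoeth : IsNoetherian (evenSubring 𝒜) (α.homGE X X n) :=
    α.isNoetherian_evenSubring (isNoetherian_of_le (α.homGE_anti X X h₁))
  have hfin : Module.Finite (evenSubring 𝒜) (α.homGE X X n) := inferInstance
  set I := Module.annihilator (evenSubring 𝒜) (α.homGE X X n) with hI
  have hAN : IsNoetherianRing (evenSubring 𝒜 ⧸ I) := isNoetherianRing_quotient_annihilator _ _
  have hIh : I.IsHomogeneous (evenGrading 𝒜) := α.isHomogeneous_annihilator X X n
  have hmax : ∀ p : Ideal (evenSubring 𝒜), p.IsPrime → I ≤ p →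
      (HomogeneousIdeal.irrelevant (evenGrading 𝒜)).toIdeal ≤ p → p.IsMaximal :=
    fun p hp hle hirr => α.isMaximal_of_annihilator_le hfin (fun i hi => hL i (h₂.trans hi))
      hp hle hirr
  have hcxX : α.cx X =
      (Order.krullDim (PrimeSpectrum.zeroLocus (I : Set (evenSubring 𝒜)))).unbotD 0 := by
    rw [CentralAction.cx, hn₃ n h₃, Module.supportDim, Module.support_eq_zeroLocus]
  have htop := krullDim_zeroLocus_ne_top (evenGrading 𝒜) hIh hmax
  obtain ⟨m, hm⟩ : ∃ m : ℕ,
      Order.krullDim (PrimeSpectrum.zeroLocus (I : Set (evenSubring 𝒜))) = m := by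
    generalize Order.krullDim (PrimeSpectrum.zeroLocus (I : Set (evenSubring 𝒜))) = D at *
    induction D using WithBot.recBotCoe with
    | bot => exact absurd hcxX hcx
    | coe D =>
      induction D using ENat.recTopCoe with
      | top => exact absurd rfl htop
      | coe m => exact ⟨m, rfl⟩
  have hcxm : α.cx X = m := by rw [hcxX, hm]; rfl
  have hm1 : 1 ≤ m := by
    rw [hcxm] at hcx
    exact Nat.one_le_iff_ne_zero.mpr (by exact_mod_cast hcx)
  refine ⟨by rw [hcxm]; exact ENat.natCast_ne_top m, ?_⟩
  obtain ⟨d, hd, r, hr, hupper, hlower⟩ := exists_homogeneous_krullDim_drop (evenGrading 𝒜) hIh hmax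
    (by rw [hm]; exact_mod_cast hm1)
  refine ⟨d, ⟨r, hr⟩, hd, ?_, fun K hK => ?_⟩
  · obtain ⟨K, g, h, hT⟩ := distinguished_cocone_triangle (α.phi X (⟨r, hr⟩ : 𝒜 d))
    exact ⟨K, g, h, hT⟩
  rw [hm] at hupper hlower
  have hcxK : α.cx X - 1 = ((m - 1 : ℕ) : ℕ∞) := by rw [hcxm]; rfl
  rw [hcxK]
  refine le_antisymm ?_ (le_iInf fun k => ?_)
  · refine (iInf_le _ (n + d + 1)).trans ?_
    have hdim : Module.supportDim (evenSubring 𝒜) (α.homGE K K (n + d + 1)) ≤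
        ((m - 1 : ℕ) : WithBot ℕ∞) := by
      refine le_trans (Order.krullDim_le_of_strictMono
        (Set.inclusion (hK.support_subset le_rfl)) fun _ _ h => h) ?_
      change Order.krullDim (PrimeSpectrum.zeroLocus
        ((I ⊔ Ideal.span {r} : Ideal (evenSubring 𝒜)) : Set (evenSubring 𝒜))) ≤ _
      generalize Order.krullDim (PrimeSpectrum.zeroLocus
        ((I ⊔ Ideal.span {r} : Ideal (evenSubring 𝒜)) : Set (evenSubring 𝒜))) = D at hupper
      rw [← Nat.sub_add_cancel hm1] at hupper
      exact le_natCast_of_add_one_le hupper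
    exact unbotD_zero_mono hdim
  · rcases Nat.lt_or_ge 1 m with hm2 | hm2
    -- For `m = 1` the required lower bound is 0.
    swap
    · have : m - 1 = 0 := by omega
      rw [this]
      exact zero_le
    have hlow : (m : WithBot ℕ∞) ≤ Order.krullDim (PrimeSpectrum.zeroLocus
        ((I ⊔ Ideal.span {r} : Ideal (evenSubring 𝒜)) : Set (evenSubring 𝒜))) + 1 :=
      hlower.resolve_left fun h => by
        have : m ≤ 1 := by exact_mod_cast h
        omega
    have hle : ((m - 1 : ℕ) : WithBot ℕ∞) ≤ Order.krullDim (PrimeSpectrum.zeroLocus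
        ((I ⊔ Ideal.span {r} : Ideal (evenSubring 𝒜)) : Set (evenSubring 𝒜))) := by
      rw [← Nat.sub_add_cancel hm1] at hlow
      exact natCast_le_of_le_add_one hlow
    have hge : Order.krullDim (PrimeSpectrum.zeroLocus
        ((I ⊔ Ideal.span {r} : Ideal (evenSubring 𝒜)) : Set (evenSubring 𝒜))) ≤
        Module.supportDim (evenSubring 𝒜) (α.homGE K K k) := by
      -- Here `m ≥ 2`, so `V(I + (r))` has positive dimension and its primes containing the
      -- irrelevant ideal, all maximal, can be ignored.
      refine krullDim_le_of_forall_isMaximal_or_mem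
        (fun p q hpq => Module.mem_support_mono hpq) (fun p hp => ?_) ?_
      · by_cases hirr : (HomogeneousIdeal.irrelevant (evenGrading 𝒜)).toIdeal ≤ p.asIdeal
        · exact Or.inl (hmax _ p.isPrime (le_sup_left.trans hp) hirr)
        · exact Or.inr (hK.mem_support hfin hp hirr k)
      · refine le_trans ?_ hle
        have : 1 ≤ m - 1 := by omega
        exact_mod_cast this
    exact unbotD_zero_mono (hle.trans hge)
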